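/- **Private van Trees inequality.** Let $B>0$, $\varepsilon\ge 0$, $d,n\ge 1$, $\Theta=[-B,B]^d$, and let $\mu$ be a $\sigma$-finite measure on a measurable space $\mathcal X$. Let $(P_\theta)_{\theta\in\Theta}$ be probability measures on $\mathcal X$ with jointly measurable densities $p_\theta(x)\ge 0$ with respect to $\mu$, which are regular in the following sense: - along every segment in $\Theta$ parallel to a coordinate axis, $\theta\mapsto p_\theta(x)$ is absolutely continuous for $\mu$-almost every $x$; - for every $\theta\in\Theta$, the partial derivatives of $\theta\mapsto p_\theta(x)$ within $\Theta$ exist for $P_\theta$-almost every $x$ (one-sided on the faces of the cube), and the components of the score $\nabla_\theta\log p_\theta(X)$ are square-integrable under $P_\theta$. So the Fisher information matrix $I_X(\theta)=\mathbb E_\theta\big[(\nabla\log p_\theta(X))^{\mathsf T}(\nabla\log p_\theta(X))\big]$ (the gradient being a row vector) exists for every $\theta\in\Theta$. A Markov kernel $\mathsf K$ from $\mathcal X$ to $\mathcal Z$ is $\varepsilon$-LDP if $\mathsf K(A|x)\le e^{\varepsilon}\mathsf K(A|x')$ for all measurable $A\subseteq\mathcal Z$ and all $x,x'\in\mathcal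 X$. Let $X_1,\dots,X_n$ be i.i.d. with law $P_\theta$, and let $Z_1,\dots,Z_n$, with values in an arbitrary measurable space $\mathcal Z$, be generated sequentially: given $Z^{i-1}=(Z_1,\dots,Z_{i-1})=z^{i-1}$ and $X_i=x$, the output $Z_i$ has law $\mathsf K_i(\cdot|z^{i-1},x)$, where $\mathsf K_i$ is a Markov kernel and $\mathsf K_i(\cdot|z^{i-1},\cdot)$ is $\varepsilon$-LDP for every $z^{i-1}$. Define the private minimax quadratic risk $$R^*(n,\Theta,\ell_2^2,\varepsilon)=\inf_{\mathsf K_1,\dots,\mathsf K_n}\ \inf_{\psi}\ \sup_{\theta\in\Theta}\ \mathbb E_\theta\big[\|\psi(Z^n)-\theta\|_2^2\big],$$ the infima being over all such kernels and over all measurable $\psi:\mathcal Z^n\to\mathbb R^d$. Then $$R^*(n,\Theta,\ell_2^2,\varepsilon)\ \ge\ \frac{d^2}{n\,\Upsilon_\varepsilon\,\sup_{\theta\in\Theta}\mathrm{Tr}\,I_X(\theta)+\frac{d\pi^2}{B^2}},\qquad \Upsilon_\varepsilon=\Big(\frac{e^\varepsilon-1}{e^\varepsilon+1}\Big)^2 ,$$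 where the right-hand side is computed in $[0,\infty]$ with $0\cdot\infty=0$ (in particular it is $0$ if $\varepsilon>0$ and the supremum is infinite). -/

import Mathlib

open MeasureTheory ProbabilityTheory
open scoped ENNReal

noncomputable section

namespace PrivateVanTrees

/-- A mechanism `κ : 𝒳 → 𝒫(𝒵)` is `ε`-locally differentially private if
`κ(A | x) ≤ e^ε κ(A | x')` for all events `A` and all inputs `x, x'`. -/
def IsLDP {X Z : Type*} [MeasurableSpace X] [MeasurableSpace Z]
    (ε : ℝ) (κ : Kernel X Z) : Prop :=
  ∀ A : Set Z, MeasurableSet A → ∀ x x' : X, κ x A ≤ ENNReal.ofReal (Real.exp ε) * κ x' A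

/-- A sequentially interactive protocol for `n` users: user `i` draws `Z_i` from
`K i (z^{i-1}, X_i)`, where `z^{i-1}` are the outputs of the previous users. -/
abbrev SeqProtocol (X Z : Type*) [MeasurableSpace X] [MeasurableSpace Z] (n : ℕ) : Type _ :=
  (i : Fin n) → Kernel ((Fin (i : ℕ) → Z) × X) Z

/-- The protocol is `ε`-private: every `K i` is a Markov kernel, and for every realization `z` of
the previous outputs, the mechanism `x ↦ K i (z, x)` is `ε`-LDP. -/
def SeqProtocol.IsPrivate {X Z : Type*} [MeasurableSpace X] [MeasurableSpace Z] {n : ℕ}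
    (ε : ℝ) (K : SeqProtocol X Z n) : Prop :=
  ∀ i : Fin n, IsMarkovKernel (K i) ∧ ∀ z : Fin (i : ℕ) → Z, IsLDP ε ((K i).sectR z)

/-- The law of `Z^n = (Z_1, …, Z_n)` when `X_1, …, X_n` are i.i.d. with law `P`: given
`Z^{k} = z`, a fresh `X_{k+1} ∼ P` is drawn and then `Z_{k+1} ∼ K_{k+1}(· | z, X_{k+1})`. -/
def outputLaw {X Z : Type*} [MeasurableSpace X] [MeasurableSpace Z] (P : Measure X) :
    (n : ℕ) → SeqProtocol X Z n → Measure (Fin n → Z)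
  | 0, _ => Measure.dirac Fin.elim0
  | n + 1, K =>
      (((outputLaw P n fun i => K i.castSucc).prod P) ⊗ₘ (K (Fin.last n))).map
        fun q => Fin.snoc (α := fun _ => Z) q.1.1 q.2

/-- The private minimax risk `R*(n, Θ, ℓ, ε)` of estimating `θ` over the family `(P θ)_{θ ∈ Θ}`,
with privatized samples taking values in `Z`: infimum over all `ε`-private sequentially interactive
protocols and all measurable estimators of the worst-case expected loss. -/
def minimaxRisk {E X : Type*} (Z : Type*) [MeasurableSpace E] [MeasurableSpace X]
    [MeasurableSpace Z] (P : E → Measure X) (n : ℕ) (Θ : Set E) (l : E → E → ℝ) (ε : ℝ) : ℝ≥0∞ :=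
  ⨅ (K : SeqProtocol X Z n) (_ : K.IsPrivate ε) (ψ : (Fin n → Z) → E) (_ : Measurable ψ),
    ⨆ θ ∈ Θ, ∫⁻ z, ENNReal.ofReal (l (ψ z) θ) ∂(outputLaw (P θ) n K)

/-- The quadratic loss `‖a - b‖₂²`. -/
def quadraticLoss {d : ℕ} (a b : EuclideanSpace ℝ (Fin d)) : ℝ := ‖a - b‖ ^ 2

/-- The cube `[-B, B]^d`. -/
def cube (d : ℕ) (B : ℝ) : Set (EuclideanSpace ℝ (Fin d)) :=
  {θ | ∀ j, θ j ∈ Set.Icc (-B) B}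

/-- The coefficient `Υ_ε = ((e^ε - 1) / (e^ε + 1))²`. -/
def upsilon (ε : ℝ) : ℝ := ((Real.exp ε - 1) / (Real.exp ε + 1)) ^ 2

section Fisher

variable {X : Type*} [MeasurableSpace X] {d : ℕ}

/-- The distribution `P_θ` with density (or probability mass function) `p θ` with respect to `μ`. -/
def law (μ : Measure X) (p : EuclideanSpace ℝ (Fin d) → X → ℝ)
    (θ : EuclideanSpace ℝ (Fin d)) : Measure X :=
  μ.withDensity fun x => ENNReal.ofReal (p θ x)

/-- The `j`-th component of the score `∇_θ log p_θ(x)`. The parameter varies within `Θ`, so this is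
the partial derivative, one-sided at the faces of a cube. -/
def score (Θ : Set (EuclideanSpace ℝ (Fin d))) (p : EuclideanSpace ℝ (Fin d) → X → ℝ)
    (θ : EuclideanSpace ℝ (Fin d)) (j : Fin d) (x : X) : ℝ :=
  lineDerivWithin ℝ (fun η => Real.log (p η x)) Θ θ (EuclideanSpace.single j 1)

/-- The Fisher information matrix `I_X(θ) = E_θ[(∇ log p_θ(X))ᵀ (∇ log p_θ(X))]`. -/
def fisherInfo (μ : Measure X) (Θ : Set (EuclideanSpace ℝ (Fin d)))
    (p : EuclideanSpace ℝ (Fin d) → X → ℝ) (θ : EuclideanSpace ℝ (Fin d)) :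
    Matrix (Fin d) (Fin d) ℝ :=
  Matrix.of fun i j => ∫ x, score Θ p θ i x * score Θ p θ j x ∂(law μ p θ)

/-- A parametric family of probability densities `(p θ)_{θ ∈ Θ}` with respect to `μ` for which the
Fisher information is meaningful. Without absolute continuity in `θ` the derivative of `log p_θ`
does not describe how `P_θ` varies (for translates of a uniform density it vanishes). -/
structure IsRegularFamily (μ : Measure X) (Θ : Set (EuclideanSpace ℝ (Fin d)))
    (p : EuclideanSpace ℝ (Fin d) → X → ℝ) : Prop where
  measurable : Measurable fun q : EuclideanSpace ℝ (Fin d) × X => p q.1 q.2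
  nonneg : ∀ θ ∈ Θ, ∀ x, 0 ≤ p θ x
  isProbabilityMeasure : ∀ θ ∈ Θ, IsProbabilityMeasure (law μ p θ)
  /-- On each segment in `Θ` parallel to a coordinate axis, `θ ↦ p_θ(x)` is absolutely continuous
  for almost every `x`. -/
  absolutelyContinuous : ∀ θ ∈ Θ, ∀ j : Fin d, ∀ s : ℝ, 0 ≤ s →
    (∀ t ∈ Set.Icc 0 s, θ + t • EuclideanSpace.single j (1 : ℝ) ∈ Θ) →
    ∀ᵐ x ∂μ, AbsolutelyContinuousOnInterval
      (fun t => p (θ + t • EuclideanSpace.single j (1 : ℝ)) x) 0 s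
  /-- At each `θ ∈ Θ` the partial derivatives of `p_θ(X)` exist almost surely under `P_θ`. -/
  differentiable : ∀ θ ∈ Θ, ∀ j : Fin d, ∀ᵐ x ∂(law μ p θ),
    LineDifferentiableWithinAt ℝ (fun η => p η x) Θ θ (EuclideanSpace.single j 1)
  /-- The matrix `I_X(θ)` exists at each `θ ∈ Θ`; no bound uniform in `θ` is required. -/
  memLp_score : ∀ θ ∈ Θ, ∀ j : Fin d, MemLp (score Θ p θ j) 2 (law μ p θ)

end Fisher

end PrivateVanTrees

end

/-! Van Trees' argument averages a Cramér–Rao bound over a smooth prior; privacy enters by shrinking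
the Fisher information of the outputs by the factor `upsilon ε`. Since `Z` is arbitrary and the
outputs need not have a density, their information matrix is never formed. Instead each bounded
statistic `g` of the outputs satisfies `(∂_j E_θ g)² ≤ n Υ I_jj(θ) Var_θ g` for almost every `θ`
(`IsRegularFamily.ae_sq_lineDeriv_le`).

For a single user this is Cauchy–Schwarz together with a contraction: an `ε`-LDP kernel maps a
statistic with mean zero and variance `V` to a conditional mean with variance at most `Υ V`
(`variance_contraction_of_centered`). For `n` users, `exists_tendsto_slope_outputLaw` conditions on
the past: the derivative splits into a term from the law of the past outputs and a term from the
last input, the variance splits in the same way, and the bounds add up.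

The differentiation needs the input laws to be differentiable in total variation. Absolute
continuity gives this only almost everywhere, through a bound on the `L¹` norm of the derivative by
the Fisher information, Lebesgue differentiation and a Scheffé-type argument
(`ae_tendsto_lintegral_slopeSeq_sub`, `IsRegularFamily.ae_tendsto_slopeSeq`). The means `E_θ g` are
moreover Lipschitz in `θ`, so an almost-everywhere bound on their derivatives is enough for
integrating against the prior.

The prior is the product of `cos²` densities, whose information is `π²/B²` in each coordinate.
Integration by parts (`natCast_le_of_ae_sum_lineDeriv_le`) compares `d` with the risk; both
quadratic inequalities are used in the linearized form `2xy ≤ x²/c + c y²` with a common `c`, chosen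
at the end. If `n = 0` or `ε = 0` the outputs carry no information and two opposite corners of the
cube suffice; if the supremum of the traces is infinite otherwise, the bound is zero. -/

namespace PrivateVanTrees

/-! ### Contraction of variance and correlation by one private mechanism. -/

section Contraction

variable {X Z : Type*} [MeasurableSpace X] [MeasurableSpace Z]

theorem integrable_of_abs_le {Y : Type*} [MeasurableSpace Y] {ν : Measure Y} [IsFiniteMeasure ν]
    {g : Y → ℝ} (hg : Measurable g) {M : ℝ} (hM : ∀ y, |g y| ≤ M) : Integrable g ν :=
  Integrable.of_bound hg.aestronglyMeasurable M (.of_forall hM)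

theorem integrable_sq_of_abs_le {Y : Type*} [MeasurableSpace Y] {ν : Measure Y}
    [IsFiniteMeasure ν] {g : Y → ℝ} (hg : Measurable g) {M : ℝ} (hM : ∀ y, |g y| ≤ M) :
    Integrable (fun y => g y ^ 2) ν := by
  refine integrable_of_abs_le (M := M ^ 2) (by fun_prop) fun y => ?_
  rw [abs_pow]
  exact pow_le_pow_left₀ (abs_nonneg _) (hM y) 2

theorem abs_integral_le_of_abs_le {Y : Type*} [MeasurableSpace Y] {ν : Measure Y}
    [IsProbabilityMeasure ν] {g : Y → ℝ} {M : ℝ} (hM : ∀ y, |g y| ≤ M) : |∫ y, g y ∂ν| ≤ M := by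
  simpa using norm_integral_le_of_norm_le_const (μ := ν) (f := g) (C := M) (.of_forall hM)

theorem integral_sub_sq {ν : Measure Z} [IsProbabilityMeasure ν] {g : Z → ℝ} (hg : Measurable g)
    {M : ℝ} (hM : ∀ z, |g z| ≤ M) (u : ℝ) :
    ∫ z, (g z - u) ^ 2 ∂ν = ∫ z, g z ^ 2 ∂ν - 2 * u * ∫ z, g z ∂ν + u ^ 2 := by
  have h1 : Integrable g ν := integrable_of_abs_le hg hM
  have h2 : Integrable (fun z => g z ^ 2) ν := integrable_sq_of_abs_le hg hM
  calc ∫ z, (g z - u) ^ 2 ∂ν = ∫ z, (g z ^ 2 - (2 * u) * g z + u ^ 2) ∂ν := by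
        congr 1; ext z; ring
    _ = _ := by
        have h3 : Integrable (fun z => g z ^ 2 - 2 * u * g z) ν := h2.sub (h1.const_mul _)
        rw [integral_add h3 (integrable_const _),
          integral_sub h2 (h1.const_mul _), integral_const_mul]
        simp

theorem integral_sq_le_exp_mul {ε : ℝ} {κ : Kernel X Z} [IsMarkovKernel κ] (hκ : IsLDP ε κ)
    {g : Z → ℝ} (hg : Measurable g) {M : ℝ} (hM : ∀ z, |g z| ≤ M) (x x' : X) :
    ∫ z, g z ^ 2 ∂(κ x) ≤ Real.exp ε * ∫ z, g z ^ 2 ∂(κ x') := by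
  have hle : κ x ≤ ENNReal.ofReal (Real.exp ε) • κ x' :=
    Measure.le_iff.2 fun A hA => by simpa using hκ A hA x x'
  have h2 : Integrable (fun z => g z ^ 2) (κ x') := integrable_sq_of_abs_le hg hM
  calc ∫ z, g z ^ 2 ∂(κ x) ≤ ∫ z, g z ^ 2 ∂(ENNReal.ofReal (Real.exp ε) • κ x') :=
        integral_mono_measure hle (.of_forall fun z => sq_nonneg _)
          (h2.smul_measure ENNReal.ofReal_ne_top)
    _ = _ := by
        rw [integral_smul_measure, ENNReal.toReal_ofReal (Real.exp_pos _).le, smul_eq_mul]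

/-- Contraction of an `ε`-LDP mechanism for a two-point input distribution. -/
theorem two_point_contraction {ε : ℝ} (hε : 0 < ε) {κ : Kernel X Z} [IsMarkovKernel κ]
    (hκ : IsLDP ε κ) {g : Z → ℝ} (hg : Measurable g) {M : ℝ} (hM : ∀ z, |g z| ≤ M) {x x' : X}
    {a b : ℝ} (ha : 0 < a) (hb : 0 < b) (hx : ∫ z, g z ∂(κ x) = a) (hx' : ∫ z, g z ∂(κ x') = -b) :
    a * b * (a + b) ≤
      upsilon ε * (b * ∫ z, g z ^ 2 ∂(κ x) + a * ∫ z, g z ^ 2 ∂(κ x')) := by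
  unfold upsilon
  have hE : 1 < Real.exp ε := Real.one_lt_exp_iff.2 hε
  have key : ∀ u : ℝ, ∀ y y' : X, ∫ z, g z ^ 2 ∂(κ y) - 2 * u * ∫ z, g z ∂(κ y) + u ^ 2 ≤
      Real.exp ε * (∫ z, g z ^ 2 ∂(κ y') - 2 * u * ∫ z, g z ∂(κ y') + u ^ 2) := fun u y y' => by
    rw [← integral_sub_sq hg hM, ← integral_sub_sq hg hM]
    refine integral_sq_le_exp_mul hκ (hg.sub_const u) (M := M + |u|) (fun z => ?_) y y'
    exact (abs_sub _ _).trans (by gcongr; exact hM z)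
  generalize Real.exp ε = E at *
  -- Each shift `u` minimizes the quadratic in `u` given by its inequality. The weights `b E + a`
  -- and `b + a E` used below make the two second moments appear in the ratio `b : a`.
  have h1 := key ((b + a * E) / (E - 1)) x' x
  have h2 := key (-((b * E + a) / (E - 1))) x x'
  rw [hx, hx'] at h1 h2
  generalize ∫ z, g z ^ 2 ∂(κ x) = G at *
  generalize ∫ z, g z ^ 2 ∂(κ x') = G' at *
  have hE1 : 0 < E - 1 := by linarith
  have hm1 : 0 < b * E + a := by positivity
  have hm2 : 0 < b + a * E := by positivity
  have h3 : (a + b) * ((b * E + a) * (b + a * E)) ≤ (E - 1) ^ 2 * (b * G + a * G') := by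
    have h1' := mul_le_mul_of_nonneg_left h1 hm1.le
    have h2' := mul_le_mul_of_nonneg_left h2 hm2.le
    have h4 : 0 ≤ (E ^ 2 - 1) * (b * G + a * G') - 2 * ((b + a * E) * (b * E + a) / (E - 1)) *
        ((E + 1) * (a + b)) +
        (E - 1) * ((b * E + a) * ((b + a * E) / (E - 1)) ^ 2 +
          (b + a * E) * ((b * E + a) / (E - 1)) ^ 2) := by
      have e : ∀ y : ℝ, (b + a * E) * (b * E + a) / (E - 1) * y =
        (b + a * E) * ((b * E + a) / (E - 1)) * y := fun y => by ring
      have e' : (b + a * E) * ((b * E + a) / (E - 1)) = (b * E + a) * ((b + a * E) / (E - 1)) := by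
        ring
      generalize (b + a * E) / (E - 1) = u at *
      generalize (b * E + a) / (E - 1) = v at *
      have e2 : (b + a * E) * (b * E + a) / (E - 1) = (b + a * E) * v := by
        simpa using e 1
      rw [e2]
      linear_combination h1' + h2' + (2 * (E * a + b)) * e'
    have h5 : (E - 1) * ((E ^ 2 - 1) * (b * G + a * G') -
        2 * ((b + a * E) * (b * E + a) / (E - 1)) * ((E + 1) * (a + b)) +
        (E - 1) * ((b * E + a) * ((b + a * E) / (E - 1)) ^ 2 +
          (b + a * E) * ((b * E + a) / (E - 1)) ^ 2)) =
        (E + 1) * ((E - 1) ^ 2 * (b * G + a * G') - (a + b) * ((b * E + a) * (b + a * E))) := by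
      field_simp
      ring
    have h6 : 0 ≤ (E + 1) * ((E - 1) ^ 2 * (b * G + a * G') -
        (a + b) * ((b * E + a) * (b + a * E))) := h5 ▸ mul_nonneg hE1.le h4
    have h7 := nonneg_of_mul_nonneg_right h6 (by linarith : 0 < E + 1)
    linarith
  -- The difference of the two sides is exactly `(a + b) E (a - b)²`.
  have h8 : a * b * (a + b) * (E + 1) ^ 2 ≤ (a + b) * ((b * E + a) * (b + a * E)) := by
    have : 0 ≤ (a + b) * (E * (a - b) ^ 2) := by positivity
    nlinarith
  rw [div_pow, div_mul_eq_mul_div, le_div_iff₀ (by positivity)]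
  exact h8.trans h3

/-- A Lagrange multiplier for the constraint that `h` has mean zero. The pair condition says that
every ratio `φ / h` taken where `h < 0` is at most every such ratio where `h > 0`, so the supremum
of the former separates them. This replaces a decomposition of a centered law into two-point laws.
-/
theorem exists_mul_le_of_pair {ι : Type*} (h φ : ι → ℝ) {x₀ y₀ : ι} (hx₀ : 0 < h x₀)
    (hy₀ : h y₀ < 0) (hz : ∀ x, h x = 0 → 0 ≤ φ x)
    (hpair : ∀ x y, 0 < h x → h y < 0 → 0 ≤ -h y * φ x + h x * φ y) :
    ∃ c : ℝ, ∀ x, c * h x ≤ φ x := by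
  have hle : ∀ x y, 0 < h x → h y < 0 → φ y / h y ≤ φ x / h x := fun x y hx hy => by
    rw [div_le_iff_of_neg hy, div_mul_eq_mul_div, div_le_iff₀ hx]
    nlinarith [hpair x y hx hy]
  let S := (fun y => φ y / h y) '' {y | h y < 0}
  have hS : ∀ x, 0 < h x → φ x / h x ∈ upperBounds S := by
    rintro x hx _ ⟨y, hy, rfl⟩
    exact hle x y hx hy
  refine ⟨sSup S, fun x => ?_⟩
  rcases lt_trichotomy (h x) 0 with hx | hx | hx
  · rw [← div_le_iff_of_neg hx]
    exact le_csSup ⟨_, hS x₀ hx₀⟩ ⟨x, hx, rfl⟩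
  · simpa [hx] using hz x hx
  · rw [← le_div_iff₀ hx]
    exact csSup_le ⟨_, y₀, hy₀, rfl⟩ fun _ hs => hS x hx hs

theorem measurable_kernel_integral (κ : Kernel X Z) [IsMarkovKernel κ] {g : Z → ℝ}
    (hg : Measurable g) : Measurable fun x => ∫ z, g z ∂(κ x) :=
  (hg.stronglyMeasurable.integral_kernel (κ := κ)).measurable

theorem upsilon_nonneg (ε : ℝ) : 0 ≤ upsilon ε := sq_nonneg _

/-- The two-point inequality yields a multiplier `c` with `c h ≤ Υ W - h²` everywhere, and
integrating removes the left side because `h` is centered. If `h` does not take both signs, being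
centered forces it to vanish almost everywhere. -/
theorem variance_contraction_of_centered {ε : ℝ} (hε : 0 < ε) (P : Measure X)
    [IsProbabilityMeasure P]
    {κ : Kernel X Z} [IsMarkovKernel κ] (hκ : IsLDP ε κ) {g : Z → ℝ} (hg : Measurable g) {M : ℝ}
    (hM : ∀ z, |g z| ≤ M) (hmean : ∫ x, ∫ z, g z ∂(κ x) ∂P = 0) :
    ∫ x, (∫ z, g z ∂(κ x)) ^ 2 ∂P ≤ upsilon ε * ∫ x, ∫ z, g z ^ 2 ∂(κ x) ∂P := by
  set h : X → ℝ := fun x => ∫ z, g z ∂(κ x) with hh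
  set W : X → ℝ := fun x => ∫ z, g z ^ 2 ∂(κ x) with hW
  have hhm : Measurable h := measurable_kernel_integral κ hg
  have hWm : Measurable W := measurable_kernel_integral κ (hg.pow_const 2)
  have hhM : ∀ x, |h x| ≤ M := fun x => abs_integral_le_of_abs_le hM
  have hW0 : ∀ x, 0 ≤ W x := fun x => integral_nonneg fun z => sq_nonneg _
  have hWM : ∀ x, |W x| ≤ M ^ 2 := fun x => abs_integral_le_of_abs_le fun z => by
    rw [abs_pow]; exact pow_le_pow_left₀ (abs_nonneg _) (hM z) 2
  have hhi : Integrable h P := integrable_of_abs_le hhm hhM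
  have hh2i : Integrable (fun x => h x ^ 2) P := integrable_sq_of_abs_le hhm hhM
  have hWi : Integrable W P := integrable_of_abs_le hWm hWM
  have htriv : (∀ᵐ x ∂P, h x = 0) → ∫ x, h x ^ 2 ∂P ≤ upsilon ε * ∫ x, W x ∂P := fun h0 => by
    have : ∫ x, h x ^ 2 ∂P = 0 := integral_eq_zero_of_ae (by filter_upwards [h0] with x hx; simp [hx])
    rw [this]
    exact mul_nonneg (upsilon_nonneg _) (integral_nonneg hW0)
  by_cases hpos : ∃ x, 0 < h x
  swap
  · push Not at hpos
    apply htriv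
    have h1 : ∫ x, -h x ∂P = 0 := by rw [integral_neg, hmean, neg_zero]
    have h2 := (integral_eq_zero_iff_of_nonneg (fun x => neg_nonneg.2 (hpos x)) hhi.neg).1 h1
    filter_upwards [h2] with x hx using by simpa using hx
  by_cases hneg : ∃ x, h x < 0
  swap
  · push Not at hneg
    apply htriv
    exact (integral_eq_zero_iff_of_nonneg hneg hhi).1 hmean
  obtain ⟨x₀, hx₀⟩ := hpos
  obtain ⟨y₀, hy₀⟩ := hneg
  obtain ⟨c, hc⟩ := exists_mul_le_of_pair h (fun x => upsilon ε * W x - h x ^ 2) hx₀ hy₀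
    (fun x hx => by simpa [hx] using mul_nonneg (upsilon_nonneg ε) (hW0 x))
    (fun x y hx hy => by
      have := two_point_contraction hε hκ hg hM hx (neg_pos.2 hy) (x := x) (x' := y) rfl
        (neg_neg (h y)).symm
      simp only [hW]
      nlinarith)
  have h1 : ∫ x, c * h x ∂P ≤ ∫ x, (upsilon ε * W x - h x ^ 2) ∂P :=
    integral_mono (hhi.const_mul c) ((hWi.const_mul _).sub hh2i) hc
  rw [integral_const_mul, hmean, mul_zero, integral_sub (hWi.const_mul _) hh2i,
    integral_const_mul] at h1
  linarith

theorem sq_integral_mul_le {P : Measure X} {s h : X → ℝ} (hs : MemLp s 2 P) (hh : MemLp h 2 P) :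
    (∫ x, s x * h x ∂P) ^ 2 ≤ (∫ x, s x ^ 2 ∂P) * ∫ x, h x ^ 2 ∂P := by
  have hs2 := hs.integrable_sq
  have hh2 := hh.integrable_sq
  have hsh : Integrable (fun x => s x * h x) P := hs.integrable_mul hh
  have key : ∀ t : ℝ, 0 ≤ (∫ x, h x ^ 2 ∂P) * (t * t) + (-2 * ∫ x, s x * h x ∂P) * t +
      ∫ x, s x ^ 2 ∂P := fun t => by
    have : 0 ≤ ∫ x, (s x - t * h x) ^ 2 ∂P := integral_nonneg fun x => sq_nonneg _
    have e : ∫ x, (s x - t * h x) ^ 2 ∂P =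
        ∫ x, ((t * t) * h x ^ 2 + (-2 * t) * (s x * h x) + s x ^ 2) ∂P := by
      congr 1; ext x; ring
    have hi : Integrable (fun x => (t * t) * h x ^ 2 + (-2 * t) * (s x * h x)) P :=
      (hh2.const_mul _).add (hsh.const_mul _)
    rw [e, integral_add hi hs2,
      integral_add (hh2.const_mul _) (hsh.const_mul _), integral_const_mul,
      integral_const_mul] at this
    linarith
  have := discrim_le_zero key
  rw [discrim] at this
  nlinarith

/-- An `ε`-LDP mechanism contracts the correlation with a centered statistic of its input. -/
theorem sq_integral_mul_kernel_le {ε : ℝ} (hε : 0 < ε) {P : Measure X} [IsProbabilityMeasure P]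
    {κ : Kernel X Z} [IsMarkovKernel κ] (hκ : IsLDP ε κ) {g : Z → ℝ} (hg : Measurable g) {M : ℝ}
    (hM : ∀ z, |g z| ≤ M) {s : X → ℝ} (hs : MemLp s 2 P) (hs0 : ∫ x, s x ∂P = 0) :
    (∫ x, s x * ∫ z, g z ∂(κ x) ∂P) ^ 2 ≤ upsilon ε * (∫ x, s x ^ 2 ∂P) *
      (∫ x, ∫ z, g z ^ 2 ∂(κ x) ∂P - (∫ x, ∫ z, g z ∂(κ x) ∂P) ^ 2) := by
  set c := ∫ x, ∫ z, g z ∂(κ x) ∂P with hc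
  have hgi : ∀ x, Integrable g (κ x) := fun x => integrable_of_abs_le hg hM
  have hhm := measurable_kernel_integral κ hg
  have hhM : ∀ x, |∫ z, g z ∂(κ x)| ≤ M := fun x => abs_integral_le_of_abs_le hM
  have hhi : Integrable (fun x => ∫ z, g z ∂(κ x)) P := integrable_of_abs_le hhm hhM
  have hWi : Integrable (fun x => ∫ z, g z ^ 2 ∂(κ x)) P :=
    integrable_of_abs_le (M := M ^ 2) (measurable_kernel_integral κ (hg.pow_const 2)) fun x =>
      abs_integral_le_of_abs_le fun z => by
        rw [abs_pow]; exact pow_le_pow_left₀ (abs_nonneg _) (hM z) 2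
  have hgc : Measurable fun z => g z - c := hg.sub_const c
  have hgcM : ∀ z, |g z - c| ≤ M + |c| := fun z =>
    (abs_sub _ _).trans (by gcongr; exact hM z)
  have e1 : ∀ x, ∫ z, (g z - c) ∂(κ x) = ∫ z, g z ∂(κ x) - c := fun x => by
    rw [integral_sub (hgi x) (integrable_const _)]; simp
  have hcm : ∫ x, ∫ z, (g z - c) ∂(κ x) ∂P = 0 := by
    simp_rw [e1]
    rw [integral_sub hhi (integrable_const _)]
    simp [hc]
  have hvar := variance_contraction_of_centered hε P hκ hgc hgcM hcm
  have e2 : ∫ x, ∫ z, (g z - c) ^ 2 ∂(κ x) ∂P = ∫ x, ∫ z, g z ^ 2 ∂(κ x) ∂P - c ^ 2 := by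
    simp_rw [fun x => integral_sub_sq (ν := κ x) hg hM c]
    have hi : Integrable (fun x => ∫ z, g z ^ 2 ∂(κ x) - 2 * c * ∫ z, g z ∂(κ x)) P :=
      hWi.sub (hhi.const_mul _)
    rw [integral_add hi (integrable_const _),
      integral_sub hWi (hhi.const_mul _), integral_const_mul, ← hc]
    simp
    ring
  have hsi : Integrable s P := hs.integrable (by norm_num)
  have hL2 : MemLp (fun x => ∫ z, g z ∂(κ x)) 2 P :=
    MemLp.of_bound hhm.aestronglyMeasurable M (.of_forall hhM)
  have hL2' : MemLp (fun x => ∫ z, g z ∂(κ x) - c) 2 P := hL2.sub (memLp_const c)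
  -- Because `s` is centered, subtracting `c` costs nothing and turns the second moment into a
  -- variance.
  have e3 : ∫ x, s x * (∫ z, g z ∂(κ x) - c) ∂P = ∫ x, s x * ∫ z, g z ∂(κ x) ∂P := by
    simp_rw [mul_sub]
    have hi : Integrable (fun x => s x * ∫ z, g z ∂(κ x)) P := hs.integrable_mul hL2
    rw [integral_sub hi (hsi.mul_const c), integral_mul_const, hs0]
    simp
  simp_rw [e1] at hvar
  calc _ = (∫ x, s x * (∫ z, g z ∂(κ x) - c) ∂P) ^ 2 := by rw [e3]
    _ ≤ (∫ x, s x ^ 2 ∂P) * ∫ x, (∫ z, g z ∂(κ x) - c) ^ 2 ∂P := sq_integral_mul_le hs hL2'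
    _ ≤ (∫ x, s x ^ 2 ∂P) *
        (upsilon ε * (∫ x, ∫ z, g z ^ 2 ∂(κ x) ∂P - c ^ 2)) := by
        rw [← e2]
        exact mul_le_mul_of_nonneg_left hvar (integral_nonneg fun x => sq_nonneg _)
    _ = _ := by ring

end Contraction

/-! ### Induction over the users: total variation, derivative and information of the output law. -/

section OutputLaw

open Filter Topology

variable {X Z : Type*} [MeasurableSpace X] [MeasurableSpace Z]

theorem measurable_fin_snoc (n : ℕ) :
    Measurable fun q : (Fin n → Z) × Z => (Fin.snoc (α := fun _ => Z) q.1 q.2 : Fin (n + 1) → Z) := by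
  refine measurable_pi_lambda _ fun i => ?_
  induction i using Fin.lastCases with
  | last => simpa using measurable_snd
  | cast i => simpa using! (measurable_pi_apply i).comp measurable_fst

theorem measurable_snoc_fst (n : ℕ) :
    Measurable fun q : ((Fin n → Z) × X) × Z =>
      (Fin.snoc (α := fun _ => Z) q.1.1 q.2 : Fin (n + 1) → Z) :=
  (measurable_fin_snoc n).comp ((measurable_fst.comp measurable_fst).prodMk measurable_snd)

theorem isProbabilityMeasure_outputLaw (P : Measure X) [IsProbabilityMeasure P] :
    ∀ (n : ℕ) (K : SeqProtocol X Z n), (∀ i, IsMarkovKernel (K i)) →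
      IsProbabilityMeasure (outputLaw P n K)
  | 0, _, _ => by unfold outputLaw; infer_instance
  | n + 1, K, hK => by
    have := isProbabilityMeasure_outputLaw P n (fun i => K i.castSucc) fun i => hK i.castSucc
    have := hK (Fin.last n)
    unfold outputLaw
    exact Measure.isProbabilityMeasure_map (measurable_snoc_fst n).aemeasurable

/-- The conditional mean of `g (Z_1, …, Z_{n+1})` given `Z_1, …, Z_n` and `X_{n+1}`. -/
noncomputable def lastMean {n : ℕ} (K : SeqProtocol X Z (n + 1)) (g : (Fin (n + 1) → Z) → ℝ)
    (q : (Fin n → Z) × X) : ℝ :=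
  ∫ z', g (Fin.snoc (α := fun _ => Z) q.1 z') ∂(K (Fin.last n) q)

theorem measurable_lastMean {n : ℕ} {K : SeqProtocol X Z (n + 1)} (hK : ∀ i, IsMarkovKernel (K i))
    {g : (Fin (n + 1) → Z) → ℝ} (hg : Measurable g) : Measurable (lastMean K g) := by
  have := hK (Fin.last n)
  exact ((hg.comp (measurable_snoc_fst n)).stronglyMeasurable.integral_kernel_prod_right'
    (κ := K (Fin.last n))).measurable

theorem abs_lastMean_le {n : ℕ} {K : SeqProtocol X Z (n + 1)} (hK : ∀ i, IsMarkovKernel (K i))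
    {g : (Fin (n + 1) → Z) → ℝ} {M : ℝ} (hM : ∀ z, |g z| ≤ M) (q : (Fin n → Z) × X) :
    |lastMean K g q| ≤ M := by
  have := hK (Fin.last n)
  exact abs_integral_le_of_abs_le (ν := K (Fin.last n) q) fun z => hM _

theorem integral_outputLaw_succ (P : Measure X) [IsProbabilityMeasure P] {n : ℕ}
    {K : SeqProtocol X Z (n + 1)} (hK : ∀ i, IsMarkovKernel (K i))
    {g : (Fin (n + 1) → Z) → ℝ} (hg : Measurable g) {M : ℝ} (hM : ∀ z, |g z| ≤ M) :
    ∫ z, g z ∂(outputLaw P (n + 1) K) =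
      ∫ z, ∫ x, lastMean K g (z, x) ∂P ∂(outputLaw P n fun i => K i.castSucc) := by
  have := isProbabilityMeasure_outputLaw P n (fun i => K i.castSucc) fun i => hK i.castSucc
  have := hK (Fin.last n)
  rw [outputLaw, integral_map (measurable_snoc_fst n).aemeasurable hg.aestronglyMeasurable,
    Measure.integral_compProd, integral_prod]
  · rfl
  · exact integrable_of_abs_le (measurable_lastMean hK hg) (abs_lastMean_le hK hM)
  · exact integrable_of_abs_le (hg.comp (measurable_snoc_fst n)) fun q => hM _

/-- If two input laws are `τ`-close in total variation, the output laws are `n τ`-close. -/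
theorem abs_integral_outputLaw_sub_le {P P' : Measure X} [IsProbabilityMeasure P]
    [IsProbabilityMeasure P'] {τ : ℝ}
    (hτ : ∀ (φ : X → ℝ) (M : ℝ), Measurable φ → (∀ x, |φ x| ≤ M) →
      |∫ x, φ x ∂P' - ∫ x, φ x ∂P| ≤ M * τ) :
    ∀ (n : ℕ) (K : SeqProtocol X Z n), (∀ i, IsMarkovKernel (K i)) →
      ∀ (g : (Fin n → Z) → ℝ) (M : ℝ), Measurable g → (∀ z, |g z| ≤ M) →
        |∫ z, g z ∂(outputLaw P' n K) - ∫ z, g z ∂(outputLaw P n K)| ≤ n * (M * τ)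
  | 0, _, _, _, _, _, _ => by simp [outputLaw]
  | n + 1, K, hK, g, M, hg, hM => by
    have hK' := fun i : Fin n => hK i.castSucc
    have := isProbabilityMeasure_outputLaw P n (fun i => K i.castSucc) hK'
    have := isProbabilityMeasure_outputLaw P' n (fun i => K i.castSucc) hK'
    have hF := measurable_lastMean hK hg
    have hFM := abs_lastMean_le hK hM
    have hGm : ∀ (ν : Measure X) [IsProbabilityMeasure ν],
        Measurable fun z => ∫ x, lastMean K g (z, x) ∂ν := fun ν _ =>
      hF.stronglyMeasurable.integral_prod_right'.measurable
    have hGM : ∀ (ν : Measure X) [IsProbabilityMeasure ν] (z : Fin n → Z),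
        |∫ x, lastMean K g (z, x) ∂ν| ≤ M := fun ν _ z =>
      abs_integral_le_of_abs_le fun x => hFM _
    rw [integral_outputLaw_succ P hK hg hM, integral_outputLaw_succ P' hK hg hM]
    have ih := abs_integral_outputLaw_sub_le hτ n (fun i => K i.castSucc) hK' _ M (hGm P) (hGM P)
    have h1 : |∫ z, (∫ x, lastMean K g (z, x) ∂P' - ∫ x, lastMean K g (z, x) ∂P)
        ∂(outputLaw P' n fun i => K i.castSucc)| ≤ M * τ :=
      abs_integral_le_of_abs_le fun z =>
        hτ _ M (hF.comp measurable_prodMk_left) fun x => hFM _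
    rw [integral_sub (integrable_of_abs_le (hGm P') (hGM P'))
      (integrable_of_abs_le (hGm P) (hGM P))] at h1
    have h2 := (abs_sub_le _ _ _).trans (add_le_add h1 ih)
    push_cast
    linarith

/-- With `e^0 = 1` the privacy inequality holds in both directions, so each output is drawn
independently of the current input. -/
theorem outputLaw_eq_of_isPrivate_zero (P P' : Measure X) [IsProbabilityMeasure P]
    [IsProbabilityMeasure P'] :
    ∀ (n : ℕ) (K : SeqProtocol X Z n), K.IsPrivate 0 → outputLaw P n K = outputLaw P' n K
  | 0, _, _ => rfl
  | n + 1, K, hK => by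
    have hK' : ∀ i, IsMarkovKernel (K i) := fun i => (hK i).1
    have := isProbabilityMeasure_outputLaw P n (fun i => K i.castSucc) fun i => hK' i.castSucc
    have := hK' (Fin.last n)
    have ih := outputLaw_eq_of_isPrivate_zero P P' n (fun i => K i.castSucc) fun i => hK i.castSucc
    unfold outputLaw
    rw [← ih]
    ext A hA
    rw [Measure.map_apply (measurable_snoc_fst n) hA, Measure.map_apply (measurable_snoc_fst n) hA]
    have hB := measurable_snoc_fst (X := X) n hA
    rw [Measure.compProd_apply hB, Measure.compProd_apply hB]
    have hm : Measurable fun a : (Fin n → Z) × X => K (Fin.last n) a (Prod.mk a ⁻¹'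
        ((fun q : ((Fin n → Z) × X) × Z => Fin.snoc (α := fun _ => Z) q.1.1 q.2) ⁻¹' A)) :=
      Kernel.measurable_kernel_prodMk_left (κ := K (Fin.last n)) hB
    refine (lintegral_prod _ hm.aemeasurable).trans
      (Eq.trans ?_ (lintegral_prod _ hm.aemeasurable).symm)
    refine lintegral_congr fun z => ?_
    obtain ⟨x₀⟩ : Nonempty X := P.nonempty_of_neZero
    have hle : ∀ x x' : X,
        K (Fin.last n) (z, x) {b | Fin.snoc (α := fun _ => Z) z b ∈ A} ≤
        K (Fin.last n) (z, x') {b | Fin.snoc (α := fun _ => Z) z b ∈ A} := fun x x' => by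
      have := (hK (Fin.last n)).2 z {b | Fin.snoc (α := fun _ => Z) z b ∈ A}
        ((measurable_fin_snoc n).comp measurable_prodMk_left hA) x x'
      simpa using this
    have hc : ∀ ν : Measure X, IsProbabilityMeasure ν →
        ∫⁻ x, K (Fin.last n) (z, x) {b | Fin.snoc (α := fun _ => Z) z b ∈ A} ∂ν =
        K (Fin.last n) (z, x₀) {b | Fin.snoc (α := fun _ => Z) z b ∈ A} := fun ν _ => by
      rw [lintegral_congr fun x => (hle x x₀).antisymm (hle x₀ x)]
      simp
    exact (hc P inferInstance).trans (hc P' inferInstance).symm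

/-- The arithmetic of one induction step: information adds over users while variance adds over
conditioning. The cross term is bounded by AM–GM, `2uv ≤ m c β + c α`. -/
theorem sq_add_le_of_sq_le {m c α β u v : ℝ} (hm : 0 ≤ m) (hc : 0 ≤ c) (hα : 0 ≤ α) (hβ : 0 ≤ β)
    (hu : u ^ 2 ≤ m * c * α) (hv : v ^ 2 ≤ c * β) : (u + v) ^ 2 ≤ (m + 1) * c * (α + β) := by
  have h1 : (u * v) ^ 2 ≤ (m * c * β) * (c * α) := by
    rw [mul_pow]
    calc u ^ 2 * v ^ 2 ≤ (m * c * α) * (c * β) := by gcongr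
      _ = _ := by ring
  have h2 : 2 * (u * v) ≤ m * c * β + c * α := by
    refine abs_le_of_sq_le_sq' ?_ (by positivity) |>.2
    nlinarith [sq_nonneg (m * c * β - c * α)]
  nlinarith

/-- Differentiability of the output law along a family of input laws that is differentiable in
total variation with score `s`, and the resulting Fisher information bound. -/
theorem exists_tendsto_slope_outputLaw {ε : ℝ} (hε : 0 < ε) {P : Measure X}
    [IsProbabilityMeasure P] {Pk : ℕ → Measure X} [∀ k, IsProbabilityMeasure (Pk k)]
    {h δ : ℕ → ℝ} (hh : Tendsto h atTop (𝓝 0)) (hh0 : ∀ k, h k ≠ 0)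
    (hδ : Tendsto δ atTop (𝓝 0)) {s : X → ℝ} (hsm : Measurable s) (hs : MemLp s 2 P)
    (hder : ∀ (k : ℕ) (φ : X → ℝ) (M : ℝ), Measurable φ → (∀ x, |φ x| ≤ M) →
      |(∫ x, φ x ∂(Pk k) - ∫ x, φ x ∂P) / h k - ∫ x, s x * φ x ∂P| ≤ M * δ k) :
    ∀ (n : ℕ) (K : SeqProtocol X Z n), K.IsPrivate ε →
      ∀ (g : (Fin n → Z) → ℝ) (M : ℝ), Measurable g → (∀ z, |g z| ≤ M) →
        ∃ L : ℝ, Tendsto (fun k => (∫ z, g z ∂(outputLaw (Pk k) n K) -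
            ∫ z, g z ∂(outputLaw P n K)) / h k) atTop (𝓝 L) ∧
          L ^ 2 ≤ n * (upsilon ε * ∫ x, s x ^ 2 ∂P) *
            (∫ z, g z ^ 2 ∂(outputLaw P n K) - (∫ z, g z ∂(outputLaw P n K)) ^ 2)
  | 0, _, _, _, _, _, _ => ⟨0, by simp [outputLaw], by simp⟩
  | n + 1, K, hKp, g, M, hg, hM => by
    have hK : ∀ i, IsMarkovKernel (K i) := fun i => (hKp i).1
    have hK' := fun i : Fin n => hK i.castSucc
    have hQ := isProbabilityMeasure_outputLaw P n (fun i => K i.castSucc) hK'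
    have hQk := fun k => isProbabilityMeasure_outputLaw (Pk k) n (fun i => K i.castSucc) hK'
    have hsi : Integrable s P := hs.integrable (by norm_num)
    have hF := measurable_lastMean hK hg
    have hFM := abs_lastMean_le hK hM
    have hGm : ∀ (ν : Measure X) [IsProbabilityMeasure ν],
        Measurable fun z => ∫ x, lastMean K g (z, x) ∂ν := fun ν _ =>
      hF.stronglyMeasurable.integral_prod_right'.measurable
    have hGM : ∀ (ν : Measure X) [IsProbabilityMeasure ν] (z : Fin n → Z),
        |∫ x, lastMean K g (z, x) ∂ν| ≤ M := fun ν _ z =>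
      abs_integral_le_of_abs_le fun x => hFM _
    -- `G` is the conditional mean of `g` given the past outputs, and `H` is the derivative of that
    -- conditional mean when only the law of the last input moves.
    set G : (Fin n → Z) → ℝ := fun z => ∫ x, lastMean K g (z, x) ∂P with hG
    set H : (Fin n → Z) → ℝ := fun z => ∫ x, s x * lastMean K g (z, x) ∂P with hH
    have hHm : Measurable H :=
      ((hsm.comp measurable_snd).mul hF).stronglyMeasurable.integral_prod_right'.measurable
    have hHM : ∀ z, |H z| ≤ (∫ x, |s x| ∂P) * M := fun z => by
      rw [← integral_mul_const]
      refine norm_integral_le_of_norm_le (f := fun x => s x * lastMean K g (z, x))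
        (hsi.abs.mul_const M) (.of_forall fun x => ?_)
      rw [Real.norm_eq_abs, abs_mul]
      exact mul_le_mul_of_nonneg_left (hFM _) (abs_nonneg _)
    obtain ⟨L, hL, hL2⟩ := exists_tendsto_slope_outputLaw hε hh hh0 hδ hsm hs hder n
      (fun i => K i.castSucc) (fun i => hKp i.castSucc) G M (hGm P) (hGM P)
    -- For `H` only convergence of its integrals is needed, and a convergent difference quotient
    -- multiplied by `h k → 0` provides it.
    obtain ⟨L', hL', -⟩ := exists_tendsto_slope_outputLaw hε hh hh0 hδ hsm hs hder n
      (fun i => K i.castSucc) (fun i => hKp i.castSucc) H _ hHm hHM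
    set Q := outputLaw P n fun i => K i.castSucc with hQdef
    have hHlim : Tendsto (fun k => ∫ z, H z ∂(outputLaw (Pk k) n fun i => K i.castSucc)) atTop
        (𝓝 (∫ z, H z ∂Q)) := by
      have := (hL'.mul hh).add_const (∫ z, H z ∂Q)
      rw [mul_zero, zero_add] at this
      refine this.congr fun k => ?_
      rw [div_mul_cancel₀ _ (hh0 k)]
      ring
    have herr : Tendsto (fun k => ∫ z, ((∫ x, lastMean K g (z, x) ∂(Pk k) - G z) / h k - H z)
        ∂(outputLaw (Pk k) n fun i => K i.castSucc)) atTop (𝓝 0) := by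
      refine squeeze_zero_norm (a := fun k => M * δ k) (fun k => ?_) (by simpa using hδ.const_mul M)
      have := hQk k
      exact abs_integral_le_of_abs_le fun z =>
        hder k _ M (hF.comp measurable_prodMk_left) fun x => hFM _
    refine ⟨L + ∫ z, H z ∂Q, ?_, ?_⟩
    · have := hL.add (hHlim.add herr)
      rw [add_zero] at this
      refine this.congr fun k => ?_
      have := hQk k
      rw [integral_outputLaw_succ P hK hg hM, integral_outputLaw_succ (Pk k) hK hg hM]
      have i1 := integrable_of_abs_le (ν := outputLaw (Pk k) n fun i => K i.castSucc)
        (hGm (Pk k)) (hGM (Pk k))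
      have i2 := integrable_of_abs_le (ν := outputLaw (Pk k) n fun i => K i.castSucc)
        (hGm P) (hGM P)
      have i3 := integrable_of_abs_le (ν := outputLaw (Pk k) n fun i => K i.castSucc) hHm hHM
      have i4 : Integrable (fun z => (∫ x, lastMean K g (z, x) ∂(Pk k) - G z) / h k)
        (outputLaw (Pk k) n fun i => K i.castSucc) := (i1.sub i2).div_const _
      rw [integral_sub i4 i3, integral_div, integral_sub i1 i2]
      ring
    · set V : (Fin n → Z) → ℝ := fun z => ∫ x, lastMean K (fun y => g y ^ 2) (z, x) ∂P with hV
      have hgM2 : ∀ z, |g z ^ 2| ≤ M ^ 2 := fun z => by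
        rw [abs_pow]; exact pow_le_pow_left₀ (abs_nonneg _) (hM z) 2
      have hVi : Integrable V Q := integrable_of_abs_le (M := M ^ 2)
        (measurable_lastMean hK (hg.pow_const 2)).stronglyMeasurable.integral_prod_right'.measurable
        fun z => abs_integral_le_of_abs_le fun x => abs_lastMean_le hK hgM2 _
      have hGi : Integrable G Q := integrable_of_abs_le (hGm P) (hGM P)
      have hG2i : Integrable (fun z => G z ^ 2) Q := integrable_sq_of_abs_le (hGm P) (hGM P)
      -- Testing the derivative against the constant `1` shows that the score is centered, since
      -- total mass does not vary.
      have hs0 : ∫ x, s x ∂P = 0 := by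
        have h1 := fun k => hder k (fun _ => 1) 1 measurable_const (by simp)
        simp only [integral_const, probReal_univ, smul_eq_mul, mul_one, sub_self, zero_div,
          zero_sub, abs_neg, one_mul] at h1
        exact abs_nonpos_iff.1 (ge_of_tendsto' hδ h1)
      have hpt : ∀ z, H z ^ 2 ≤ upsilon ε * (∫ x, s x ^ 2 ∂P) * (V z - G z ^ 2) := fun z => by
        have := hK (Fin.last n)
        have h1 : Measurable fun z' : Z => g (Fin.snoc (α := fun _ => Z) z z') :=
          hg.comp ((measurable_fin_snoc n).comp measurable_prodMk_left)
        exact sq_integral_mul_kernel_le hε (P := P) (κ := (K (Fin.last n)).sectR z)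
          ((hKp (Fin.last n)).2 z) h1 (fun z' => hM _) hs hs0
      have hI : 0 ≤ ∫ x, s x ^ 2 ∂P := integral_nonneg fun x => sq_nonneg _
      have hJ : (∫ z, H z ∂Q) ^ 2 ≤ upsilon ε * (∫ x, s x ^ 2 ∂P) * ∫ z, (V z - G z ^ 2) ∂Q := by
        have hvar := integral_sub_sq (ν := Q) hHm hHM (∫ z, H z ∂Q)
        have h0 : 0 ≤ ∫ z, (H z - ∫ z, H z ∂Q) ^ 2 ∂Q := integral_nonneg fun z => sq_nonneg _
        have h1 : ∫ z, H z ^ 2 ∂Q ≤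
            ∫ z, upsilon ε * (∫ x, s x ^ 2 ∂P) * (V z - G z ^ 2) ∂Q :=
          integral_mono (integrable_sq_of_abs_le hHm hHM) ((hVi.sub hG2i).const_mul _) hpt
        rw [integral_const_mul] at h1
        nlinarith
      have hα : 0 ≤ ∫ z, G z ^ 2 ∂Q - (∫ z, G z ∂Q) ^ 2 := by
        have hvar := integral_sub_sq (ν := Q) (hGm P) (hGM P) (∫ z, G z ∂Q)
        have h0 : 0 ≤ ∫ z, (G z - ∫ z, G z ∂Q) ^ 2 ∂Q := integral_nonneg fun z => sq_nonneg _
        simp only [hG] at *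
        nlinarith
      -- This is the mean conditional variance given the past; added to the variance of `G` it gives
      -- the variance of `g`.
      have hβ : 0 ≤ ∫ z, (V z - G z ^ 2) ∂Q := by
        refine integral_nonneg fun z => ?_
        have hF2 : ∀ x, lastMean K g (z, x) ^ 2 ≤ lastMean K (fun y => g y ^ 2) (z, x) := fun x => by
          have := hK (Fin.last n)
          have h1 : Measurable fun z' : Z => g (Fin.snoc (α := fun _ => Z) z z') :=
            hg.comp ((measurable_fin_snoc n).comp measurable_prodMk_left)
          have hvar := integral_sub_sq (ν := K (Fin.last n) (z, x)) h1 (fun z' => hM _)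
            (lastMean K g (z, x))
          have h0 : 0 ≤ ∫ z', (g (Fin.snoc (α := fun _ => Z) z z') - lastMean K g (z, x)) ^ 2
            ∂(K (Fin.last n) (z, x)) := integral_nonneg fun z => sq_nonneg _
          simp only [lastMean] at *
          nlinarith
        have hFz : Measurable fun x => lastMean K g (z, x) := hF.comp measurable_prodMk_left
        have h2 : ∫ x, lastMean K g (z, x) ^ 2 ∂P ≤ V z :=
          integral_mono (integrable_sq_of_abs_le hFz fun x => hFM _)
            (integrable_of_abs_le ((measurable_lastMean hK (hg.pow_const 2)).comp
              measurable_prodMk_left) fun x => abs_lastMean_le hK hgM2 _) hF2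
        have hvar := integral_sub_sq (ν := P) hFz (fun x => hFM _) (G z)
        have h0 : 0 ≤ ∫ x, (lastMean K g (z, x) - G z) ^ 2 ∂P := integral_nonneg fun z => sq_nonneg _
        simp only [hG, Pi.zero_apply] at *
        nlinarith
      have hfin := sq_add_le_of_sq_le n.cast_nonneg (mul_nonneg (upsilon_nonneg ε) hI) hα hβ hL2 hJ
      rw [integral_outputLaw_succ P hK hg hM,
        integral_outputLaw_succ P hK (hg.pow_const 2) hgM2]
      rw [integral_sub hVi hG2i] at hfin
      push_cast
      refine hfin.trans (le_of_eq ?_)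
      ring

end OutputLaw

/-! ### Differentiability in total variation along a line. -/

section Slope

open Filter Topology Set

variable {X : Type*}

/-- A sequence of positive increments tending to zero. -/
noncomputable def step (k : ℕ) : ℝ := 1 / ((k : ℝ) + 1)

theorem step_pos (k : ℕ) : 0 < step k := by unfold step; positivity

theorem tendsto_step : Tendsto step atTop (𝓝 0) := tendsto_one_div_add_atTop_nhds_zero_nat

/-- Difference quotient of `θ ↦ p θ x` in the direction `v`. -/
noncomputable def slopeSeq {V : Type*} [AddCommGroup V] [Module ℝ V] (v : V) (p : V → X → ℝ)
    (k : ℕ) (θ : V) (x : X) : ℝ :=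
  (p (θ + step k • v) x - p θ x) / step k

/-- Limit of the difference quotients of `θ ↦ p θ x` in the direction `v`. -/
noncomputable def slopeLim {V : Type*} [AddCommGroup V] [Module ℝ V] (v : V) (p : V → X → ℝ)
    (θ : V) (x : X) : ℝ :=
  limUnder atTop fun k => slopeSeq v p k θ x

section Param

variable {V : Type*} [AddCommGroup V] [Module ℝ V]

theorem slopeSeq_line (v : V) (p : V → X → ℝ) (θ : V) (k : ℕ) (t : ℝ) (x : X) :
    slopeSeq (1 : ℝ) (fun t => p (θ + t • v)) k t x = slopeSeq v p k (θ + t • v) x := by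
  simp [slopeSeq, add_smul, add_assoc]

theorem slopeLim_line (v : V) (p : V → X → ℝ) (θ : V) (t : ℝ) (x : X) :
    slopeLim (1 : ℝ) (fun t => p (θ + t • v)) t x = slopeLim v p (θ + t • v) x := by
  simp [slopeLim, slopeSeq_line]

variable [MeasurableSpace X] [MeasurableSpace V] [MeasurableAdd V]

theorem measurable_slopeSeq (v : V) {p : V → X → ℝ} (hp : Measurable fun q : V × X => p q.1 q.2)
    (k : ℕ) : Measurable fun q : V × X => slopeSeq v p k q.1 q.2 :=
  ((hp.comp ((measurable_fst.add_const _).prodMk measurable_snd)).sub hp).div_const _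

/-- Joint measurability, needed for Fubini, is the reason for taking a limit along one fixed
sequence: `limUnder` of measurable functions is measurable even where the limit fails to exist. -/
theorem measurable_slopeLim (v : V) {p : V → X → ℝ} (hp : Measurable fun q : V × X => p q.1 q.2) :
    Measurable fun q : V × X => slopeLim v p q.1 q.2 :=
  (StronglyMeasurable.limUnder fun k => (measurable_slopeSeq v hp k).stronglyMeasurable).measurable

theorem measurable_slopeSeq_right (v : V) {p : V → X → ℝ}
    (hp : Measurable fun q : V × X => p q.1 q.2) (k : ℕ) (θ : V) : Measurable (slopeSeq v p k θ) :=
  (measurable_slopeSeq v hp k).comp measurable_prodMk_left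

theorem measurable_slopeLim_right (v : V) {p : V → X → ℝ}
    (hp : Measurable fun q : V × X => p q.1 q.2) (θ : V) : Measurable (slopeLim v p θ) :=
  (StronglyMeasurable.limUnder fun k =>
    (measurable_slopeSeq_right v hp k θ).stronglyMeasurable).measurable

end Param

theorem tendsto_slopeSeq_of_hasDerivAt {f : ℝ → X → ℝ} {t f' : ℝ} {x : X}
    (h : HasDerivAt (fun t => f t x) f' t) :
    Tendsto (fun k => slopeSeq (1 : ℝ) f k t x) atTop (𝓝 f') := by
  have h1 : Tendsto step atTop (𝓝[≠] 0) :=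
    tendsto_nhdsWithin_iff.2 ⟨tendsto_step, .of_forall fun k => (step_pos k).ne'⟩
  refine (h.tendsto_slope_zero.comp h1).congr fun k => ?_
  simp [slopeSeq, div_eq_inv_mul]

theorem slopeLim_eq_of_hasDerivAt {f : ℝ → X → ℝ} {t f' : ℝ} {x : X}
    (h : HasDerivAt (fun t => f t x) f' t) : slopeLim (1 : ℝ) f t x = f' :=
  (tendsto_slopeSeq_of_hasDerivAt h).limUnder_eq

theorem ae_hasDerivAt_slopeLim {f : ℝ → X → ℝ} {S : ℝ} {x : X}
    (hf : AbsolutelyContinuousOnInterval (fun t => f t x) 0 S) :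
    ∀ᵐ t, t ∈ Icc 0 S → HasDerivAt (fun t => f t x) (slopeLim (1 : ℝ) f t x) t := by
  filter_upwards [hf.ae_differentiableAt] with t ht hts
  have h := (ht (Icc_subset_uIcc hts)).hasDerivAt
  rwa [slopeLim_eq_of_hasDerivAt h]

theorem enorm_sub_le_lintegral_slopeLim {f : ℝ → X → ℝ} {S : ℝ} {x : X}
    (hf : AbsolutelyContinuousOnInterval (fun t => f t x) 0 S) {a b : ℝ} (ha : 0 ≤ a) (hab : a ≤ b)
    (hb : b ≤ S) : ‖f b x - f a x‖ₑ ≤ ∫⁻ u in Ioc a b, ‖slopeLim (1 : ℝ) f u x‖ₑ := by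
  have hac : AbsolutelyContinuousOnInterval (fun t => f t x) a b := hf.mono <| by
    rw [uIcc_of_le hab, uIcc_of_le (ha.trans (hab.trans hb))]
    exact Icc_subset_Icc ha hb
  rw [← hac.integral_deriv_eq_sub, intervalIntegral.integral_of_le hab]
  refine (enorm_integral_le_lintegral_enorm _).trans (le_of_eq ?_)
  refine lintegral_congr_ae ?_
  filter_upwards [ae_restrict_of_ae (ae_hasDerivAt_slopeLim hf), ae_restrict_mem measurableSet_Ioc]
    with u hu huab
  rw [(hu ⟨ha.trans huab.1.le, huab.2.trans hb⟩).deriv]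

variable [MeasurableSpace X]

/-- An upper bound for the limit of the `L¹` norms improves convergence almost everywhere to
convergence in `L¹`. -/
theorem tendsto_lintegral_enorm_sub_of_tendsto_ae {μ : Measure X} {q : ℕ → X → ℝ} {D : X → ℝ}
    (hq : ∀ k, Measurable (q k)) (hD : Measurable D)
    (hlim : ∀ᵐ x ∂μ, Tendsto (fun k => q k x) atTop (𝓝 (D x)))
    (hfin : ∫⁻ x, ‖D x‖ₑ ∂μ ≠ ∞) {c : ℕ → ℝ≥0∞}
    (hc : Tendsto c atTop (𝓝 (∫⁻ x, ‖D x‖ₑ ∂μ)))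
    (hqc : ∀ᶠ k in atTop, ∫⁻ x, ‖q k x‖ₑ ∂μ ≤ c k) :
    Tendsto (fun k => ∫⁻ x, ‖q k x - D x‖ₑ ∂μ) atTop (𝓝 0) := by
  set I := ∫⁻ x, ‖D x‖ₑ ∂μ with hI
  -- Fatou is applied to this nonnegative sequence, which tends to `2 ‖D x‖ₑ` almost everywhere; the
  -- bound on the norms of `q k` then leaves no mass for `q k - D`.
  set F : ℕ → X → ℝ≥0∞ := fun k x => ‖q k x‖ₑ + ‖D x‖ₑ - ‖q k x - D x‖ₑ with hF
  have hFm : ∀ k, Measurable (F k) := fun k =>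
    ((hq k).enorm.add hD.enorm).sub ((hq k).sub hD).enorm
  have hsum : ∀ k, ∫⁻ x, F k x ∂μ + ∫⁻ x, ‖q k x - D x‖ₑ ∂μ = ∫⁻ x, ‖q k x‖ₑ ∂μ + I := fun k => by
    rw [← lintegral_add_left (hFm k), hI, ← lintegral_add_left (hq k).enorm]
    exact lintegral_congr fun x => tsub_add_cancel_of_le (enorm_sub_le)
  have hfatou : 2 * I ≤ liminf (fun k => ∫⁻ x, F k x ∂μ) atTop := by
    refine le_trans (le_of_eq ?_) (lintegral_liminf_le hFm)
    rw [hI, ← lintegral_const_mul _ hD.enorm]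
    refine lintegral_congr_ae ?_
    filter_upwards [hlim] with x hx
    have h1 : Tendsto (fun k => F k x) atTop (𝓝 (‖D x‖ₑ + ‖D x‖ₑ - 0)) := by
      refine ENNReal.Tendsto.sub (hx.enorm.add tendsto_const_nhds) ?_ (by simp)
      simpa using (hx.sub_const (D x)).enorm
    rw [h1.liminf_eq, tsub_zero, two_mul]
  rw [ENNReal.tendsto_nhds_zero]
  intro η hη
  obtain rfl | hη' := eq_or_ne η ∞
  · simp
  have hη2 : η / 2 ≠ 0 := by simpa using hη.ne'
  have hη3 : η / 2 ≠ ∞ := (ENNReal.div_lt_top hη' (by simp)).ne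
  have e1 : ∀ᶠ k in atTop, 2 * I - η / 2 ≤ ∫⁻ x, F k x ∂μ := by
    obtain h0 | h0 := eq_or_ne I 0
    · simp [h0]
    · have h2 : 2 * I - η / 2 < liminf (fun k => ∫⁻ x, F k x ∂μ) atTop :=
        (ENNReal.sub_lt_self (ENNReal.mul_ne_top (by simp) hfin) (by simpa using h0) hη2).trans_le
          hfatou
      exact (eventually_lt_of_lt_liminf h2).mono fun k hk => hk.le
  have e2 : ∀ᶠ k in atTop, c k ≤ I + η / 2 := by
    have : I < I + η / 2 := ENNReal.lt_add_right hfin hη2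
    exact (hc.eventually_lt_const this).mono fun k hk => hk.le
  filter_upwards [e1, e2, hqc] with k h1 h2 h3
  have h4 : 2 * I - η / 2 + ∫⁻ x, ‖q k x - D x‖ₑ ∂μ ≤ 2 * I + η / 2 := calc
    _ ≤ ∫⁻ x, F k x ∂μ + ∫⁻ x, ‖q k x - D x‖ₑ ∂μ := by gcongr
    _ = ∫⁻ x, ‖q k x‖ₑ ∂μ + I := hsum k
    _ ≤ I + η / 2 + I := by gcongr; exact h3.trans h2
    _ = _ := by ring
  have h5 : 2 * I + ∫⁻ x, ‖q k x - D x‖ₑ ∂μ ≤ 2 * I + η := calc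
    _ ≤ (2 * I - η / 2 + η / 2) + ∫⁻ x, ‖q k x - D x‖ₑ ∂μ := by gcongr; exact le_tsub_add
    _ = (2 * I - η / 2 + ∫⁻ x, ‖q k x - D x‖ₑ ∂μ) + η / 2 := by ring
    _ ≤ 2 * I + η / 2 + η / 2 := by gcongr
    _ = 2 * I + η := by rw [add_assoc, ENNReal.add_halves]
  exact (ENNReal.add_le_add_iff_left (ENNReal.mul_ne_top (by simp) hfin)).1 h5

/-- Right averages of a bounded function converge almost everywhere. -/
theorem ae_tendsto_setLIntegral_Ioc_div {N : ℝ → ℝ≥0∞} (hN : Measurable N) {C : ℝ≥0∞} (hC : C ≠ ∞)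
    {S : ℝ} (hNC : ∀ᵐ t, t ∈ Ioo 0 S → N t ≤ C) :
    ∀ᵐ t, t ∈ Ioo 0 S → Tendsto
      (fun k => (∫⁻ u in Ioc t (t + step k), N u) / ENNReal.ofReal (step k)) atTop (𝓝 (N t)) := by
  set n : ℝ → ℝ := (Ioo 0 S).indicator fun t => (N t).toReal with hn
  have hnm : Measurable n := hN.ennreal_toReal.indicator measurableSet_Ioo
  have hni : Integrable n := by
    rw [hn, integrable_indicator_iff measurableSet_Ioo]
    refine Integrable.of_bound (C := C.toReal) hN.ennreal_toReal.aestronglyMeasurable ?_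
    filter_upwards [ae_restrict_of_ae hNC, ae_restrict_mem measurableSet_Ioo] with t ht hts
    rw [Real.norm_of_nonneg ENNReal.toReal_nonneg]
    exact ENNReal.toReal_mono hC (ht hts)
  filter_upwards [LocallyIntegrable.ae_hasDerivAt_integral hni.locallyIntegrable, hNC] with t ht htC hts
  have h1 : Tendsto step atTop (𝓝[≠] 0) :=
    tendsto_nhdsWithin_iff.2 ⟨tendsto_step, .of_forall fun k => (step_pos k).ne'⟩
  have h2 := ENNReal.tendsto_ofReal ((ht t).tendsto_slope_zero.comp h1)
  have hNt : ENNReal.ofReal (n t) = N t := by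
    simp only [hn, indicator_of_mem hts]
    exact ENNReal.ofReal_toReal ((htC hts).trans_lt hC.lt_top).ne
  rw [hNt] at h2
  refine h2.congr' ?_
  have h3 : ∀ᶠ k in atTop, t + step k < S := by
    have : Tendsto (fun k => t + step k) atTop (𝓝 (t + 0)) := tendsto_step.const_add t
    rw [add_zero] at this
    exact this.eventually_lt_const hts.2
  filter_upwards [h3] with k hk
  have hsub : Ioc t (t + step k) ⊆ Ioo 0 S := fun u hu =>
    ⟨hts.1.trans hu.1, hu.2.trans_lt hk⟩
  have h4 : ∫ u in t..(t + step k), n u = (∫⁻ u in Ioc t (t + step k), N u).toReal := by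
    rw [intervalIntegral.integral_of_le (by linarith [step_pos k]), ← integral_toReal
      hN.aemeasurable]
    · refine setIntegral_congr_fun measurableSet_Ioc fun u hu => ?_
      simp [hn, indicator_of_mem (hsub hu)]
    · filter_upwards [ae_restrict_of_ae hNC, ae_restrict_mem measurableSet_Ioc] with u hu hus
      exact (hu (hsub hus)).trans_lt hC.lt_top
  have h5 : ∫⁻ u in Ioc t (t + step k), N u ≠ ∞ := by
    refine ne_top_of_le_ne_top (b := C * volume (Ioc t (t + step k))) ?_ ?_
    · rw [Real.volume_Ioc]; exact ENNReal.mul_ne_top hC ENNReal.ofReal_ne_top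
    · rw [← setLIntegral_const]
      refine lintegral_mono_ae ?_
      filter_upwards [ae_restrict_of_ae hNC, ae_restrict_mem measurableSet_Ioc] with u hu hus
      exact hu (hsub hus)
  simp only [Function.comp_apply, intervalIntegral.integral_same, sub_zero, smul_eq_mul]
  rw [h4, mul_comm, ← div_eq_mul_inv, ENNReal.ofReal_div_of_pos (step_pos k),
    ENNReal.ofReal_toReal h5]

section Line

variable {μ : Measure X} [SigmaFinite μ] {f : ℝ → X → ℝ}
  {S : ℝ}

/-- For almost every `x` an absolutely continuous function is differentiable at almost every `t`,
and Fubini exchanges the quantifiers. A zero of the nonnegative `f` at an interior point is a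
minimum, so the derivative vanishes there. -/
theorem ae_ae_tendsto_slopeSeq (hf : Measurable fun q : ℝ × X => f q.1 q.2)
    (hf0 : ∀ t ∈ Icc 0 S, ∀ x, 0 ≤ f t x)
    (hac : ∀ᵐ x ∂μ, AbsolutelyContinuousOnInterval (fun t => f t x) 0 S) :
    ∀ᵐ t, ∀ᵐ x ∂μ, t ∈ Ioo 0 S →
      Tendsto (fun k => slopeSeq (1 : ℝ) f k t x) atTop (𝓝 (slopeLim (1 : ℝ) f t x)) ∧
        (f t x = 0 → slopeLim (1 : ℝ) f t x = 0) := by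
  have hD := measurable_slopeLim (1 : ℝ) hf
  have hms : MeasurableSet {q : ℝ × X | q.1 ∈ Ioo 0 S →
      Tendsto (fun k => slopeSeq (1 : ℝ) f k q.1 q.2) atTop (𝓝 (slopeLim (1 : ℝ) f q.1 q.2)) ∧
        (f q.1 q.2 = 0 → slopeLim (1 : ℝ) f q.1 q.2 = 0)} := by
    refine MeasurableSet.imp (measurable_fst measurableSet_Ioo) (MeasurableSet.inter
      (measurableSet_tendsto_fun (measurable_slopeSeq (1 : ℝ) hf) hD)
      (MeasurableSet.imp (hf (measurableSet_singleton 0)) (hD (measurableSet_singleton 0))))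
  refine (Measure.ae_ae_comm (p := fun t x => t ∈ Ioo 0 S →
      Tendsto (fun k => slopeSeq (1 : ℝ) f k t x) atTop (𝓝 (slopeLim (1 : ℝ) f t x)) ∧
        (f t x = 0 → slopeLim (1 : ℝ) f t x = 0)) hms).2 ?_
  filter_upwards [hac] with x hx
  filter_upwards [ae_hasDerivAt_slopeLim hx] with t ht hts
  have hd := ht (Ioo_subset_Icc_self hts)
  refine ⟨tendsto_slopeSeq_of_hasDerivAt hd, fun h0 => ?_⟩
  have hmin : IsLocalMin (fun t => f t x) t := by
    filter_upwards [Icc_mem_nhds hts.1 hts.2] with u hu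
    rw [h0]
    exact hf0 u hu x
  exact hmin.hasDerivAt_eq_zero hd

theorem lintegral_enorm_sub_le (hf : Measurable fun q : ℝ × X => f q.1 q.2)
    (hac : ∀ᵐ x ∂μ, AbsolutelyContinuousOnInterval (fun t => f t x) 0 S)
    {a b : ℝ} (ha : 0 ≤ a) (hab : a ≤ b) (hb : b ≤ S) :
    ∫⁻ x, ‖f b x - f a x‖ₑ ∂μ ≤ ∫⁻ u in Ioc a b, ∫⁻ x, ‖slopeLim (1 : ℝ) f u x‖ₑ ∂μ := by
  rw [lintegral_lintegral_swap (measurable_slopeLim (1 : ℝ) hf).enorm.aemeasurable]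
  refine lintegral_mono_ae ?_
  filter_upwards [hac] with x hx
  exact enorm_sub_le_lintegral_slopeLim hx ha hab hb

/-- The score controls the derivative only where the density is nonzero; elsewhere the derivative is
almost everywhere zero for almost every `t`. -/
theorem ae_lintegral_slopeLim_le (hf : Measurable fun q : ℝ × X => f q.1 q.2)
    (hf0 : ∀ t ∈ Icc 0 S, ∀ x, 0 ≤ f t x)
    (hac : ∀ᵐ x ∂μ, AbsolutelyContinuousOnInterval (fun t => f t x) 0 S) {C : ℝ≥0∞}
    (hC : ∀ t ∈ Ioo 0 S, ∫⁻ x in {x | f t x ≠ 0}, ‖slopeLim (1 : ℝ) f t x‖ₑ ∂μ ≤ C) :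
    ∀ᵐ t, t ∈ Ioo 0 S → ∫⁻ x, ‖slopeLim (1 : ℝ) f t x‖ₑ ∂μ ≤ C := by
  filter_upwards [ae_ae_tendsto_slopeSeq hf hf0 hac] with t ht hts
  have hms : MeasurableSet {x | f t x ≠ 0} :=
    (hf.comp measurable_prodMk_left) (measurableSet_singleton 0).compl
  rw [← lintegral_add_compl _ hms, (_ : ∫⁻ x in {x | f t x ≠ 0}ᶜ, _ ∂μ = 0), add_zero]
  · exact hC t hts
  · refine (lintegral_eq_zero_of_ae_eq_zero ?_)
    filter_upwards [ae_restrict_of_ae ht, ae_restrict_mem hms.compl] with x hx hx0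
    simp [(hx hts).2 (by simpa using hx0)]

/-- Bound on the total variation along a line by the bound on the `L¹` norm of the derivative. -/
theorem lintegral_enorm_sub_le_mul (hf : Measurable fun q : ℝ × X => f q.1 q.2)
    (hf0 : ∀ t ∈ Icc 0 S, ∀ x, 0 ≤ f t x)
    (hac : ∀ᵐ x ∂μ, AbsolutelyContinuousOnInterval (fun t => f t x) 0 S) {C : ℝ≥0∞}
    (hC : ∀ t ∈ Ioo 0 S, ∫⁻ x in {x | f t x ≠ 0}, ‖slopeLim (1 : ℝ) f t x‖ₑ ∂μ ≤ C)
    {a b : ℝ} (ha : 0 ≤ a) (hab : a ≤ b) (hb : b ≤ S) :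
    ∫⁻ x, ‖f b x - f a x‖ₑ ∂μ ≤ C * ENNReal.ofReal (b - a) := by
  refine (lintegral_enorm_sub_le hf hac ha hab hb).trans ?_
  rw [← Real.volume_Ioc, ← setLIntegral_const, ← Measure.restrict_congr_set Ioo_ae_eq_Ioc]
  refine lintegral_mono_ae ?_
  filter_upwards [ae_restrict_of_ae (ae_lintegral_slopeLim_le hf hf0 hac hC),
    ae_restrict_mem measurableSet_Ioo] with u hu hus
  exact hu ⟨ha.trans_lt hus.1, hus.2.trans_le hb⟩

/-- Differentiability in total variation at almost every point of a line. -/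
theorem ae_tendsto_lintegral_slopeSeq_sub (hf : Measurable fun q : ℝ × X => f q.1 q.2)
    (hf0 : ∀ t ∈ Icc 0 S, ∀ x, 0 ≤ f t x)
    (hac : ∀ᵐ x ∂μ, AbsolutelyContinuousOnInterval (fun t => f t x) 0 S) {C : ℝ≥0∞} (hCtop : C ≠ ∞)
    (hC : ∀ t ∈ Ioo 0 S, ∫⁻ x in {x | f t x ≠ 0}, ‖slopeLim (1 : ℝ) f t x‖ₑ ∂μ ≤ C) :
    ∀ᵐ t, t ∈ Ioo 0 S →
      Tendsto (fun k => ∫⁻ x, ‖slopeSeq (1 : ℝ) f k t x - slopeLim (1 : ℝ) f t x‖ₑ ∂μ) atTop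
        (𝓝 0) := by
  have hD := measurable_slopeLim (1 : ℝ) hf
  have hNm : Measurable fun t => ∫⁻ x, ‖slopeLim (1 : ℝ) f t x‖ₑ ∂μ := hD.enorm.lintegral_prod_right'
  have hNC := ae_lintegral_slopeLim_le hf hf0 hac hC
  have hav := ae_tendsto_setLIntegral_Ioc_div hNm hCtop hNC
  filter_upwards [ae_ae_tendsto_slopeSeq hf hf0 hac, hNC, hav] with t h1 h2 h3 hts
  have hlim : ∀ᵐ x ∂μ, Tendsto (fun k => slopeSeq (1 : ℝ) f k t x) atTop
      (𝓝 (slopeLim (1 : ℝ) f t x)) := h1.mono fun x hx => (hx hts).1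
  have hqm := fun k => measurable_slopeSeq_right (1 : ℝ) hf k t
  have hDm := measurable_slopeLim_right (1 : ℝ) hf t
  have hfin : ∫⁻ x, ‖slopeLim (1 : ℝ) f t x‖ₑ ∂μ ≠ ∞ := ((h2 hts).trans_lt hCtop.lt_top).ne
  -- The `L¹` norm of the difference quotient is at most the average over `(t, t + step k]` of the
  -- `L¹` norm of the derivative, and at almost every `t` these averages converge to its value at
  -- `t`.
  refine tendsto_lintegral_enorm_sub_of_tendsto_ae hqm hDm hlim hfin (h3 hts) ?_
  have h4 : ∀ᶠ k in atTop, t + step k < S := by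
    have : Tendsto (fun k => t + step k) atTop (𝓝 (t + 0)) := tendsto_step.const_add t
    rw [add_zero] at this
    exact this.eventually_lt_const hts.2
  filter_upwards [h4] with k hk
  rw [ENNReal.le_div_iff_mul_le (by simp [step_pos]) (by simp), mul_comm,
    ← lintegral_const_mul' _ _ ENNReal.ofReal_ne_top]
  refine le_trans (le_of_eq ?_) (lintegral_enorm_sub_le hf hac hts.1.le
    (by linarith [step_pos k]) hk.le)
  refine lintegral_congr fun x => ?_
  have e : slopeSeq (1 : ℝ) f k t x * step k = f (t + step k) x - f t x := by
    rw [slopeSeq, div_mul_cancel₀ _ (step_pos k).ne', smul_eq_mul, mul_one]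
  rw [← e, enorm_mul, mul_comm, Real.enorm_of_nonneg (step_pos k).le]

end Line

end Slope

/-! ### The `cos²` prior and the integrated van Trees inequality. -/

section Prior

open Filter Topology Set

/-- The unnormalized prior density `cos² (π t / (2 B))` on `[-B, B]`, extended by zero. -/
noncomputable def cosPrior (B t : ℝ) : ℝ :=
  (1 + Real.cos (Real.pi / B * max (-B) (min t B))) / 2

variable {B : ℝ}

theorem cosPrior_nonneg (B t : ℝ) : 0 ≤ cosPrior B t := by
  unfold cosPrior
  linarith [Real.neg_one_le_cos (Real.pi / B * max (-B) (min t B))]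

theorem cosPrior_le_one (B t : ℝ) : cosPrior B t ≤ 1 := by
  unfold cosPrior
  linarith [Real.cos_le_one (Real.pi / B * max (-B) (min t B))]

theorem cosPrior_of_mem {t : ℝ} (ht : t ∈ Icc (-B) B) :
    cosPrior B t = (1 + Real.cos (Real.pi / B * t)) / 2 := by
  rw [cosPrior, min_eq_left ht.2, max_eq_right ht.1]

theorem cosPrior_of_notMem (hB : 0 < B) {t : ℝ} (ht : t ∉ Ioo (-B) B) : cosPrior B t = 0 := by
  rcases le_or_gt t (-B) with h | h
  · rw [cosPrior, min_eq_left (by linarith), max_eq_left h, mul_neg, div_mul_cancel₀ _ hB.ne',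
      Real.cos_neg, Real.cos_pi]
    norm_num
  · have h' : B ≤ t := not_lt.1 fun h' => ht ⟨h, h'⟩
    rw [cosPrior, min_eq_right h', max_eq_right (by linarith), div_mul_cancel₀ _ hB.ne',
      Real.cos_pi]
    norm_num

theorem hasDerivAt_cosPrior {t : ℝ} (ht : t ∈ Ioo (-B) B) :
    HasDerivAt (cosPrior B) (-(Real.pi / (2 * B) * Real.sin (Real.pi / B * t))) t := by
  have h1 : HasDerivAt (fun t => (1 + Real.cos (Real.pi / B * t)) / 2)
      (-(Real.pi / (2 * B) * Real.sin (Real.pi / B * t))) t := by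
    have := ((((hasDerivAt_id t).const_mul (Real.pi / B)).cos).const_add 1).div_const 2
    refine this.congr_deriv ?_
    simp only [id_eq]
    ring
  refine h1.congr_of_eventuallyEq ?_
  filter_upwards [Icc_mem_nhds ht.1 ht.2] with u hu using cosPrior_of_mem hu

/-- A division-free form of `λ'²/λ = (π²/B²)(1 - λ)`, the integrand of the information of the prior;
it is what makes `flatPrior - cubePrior` appear later. -/
theorem sq_deriv_cosPrior {t : ℝ} (ht : t ∈ Ioo (-B) B) :
    (Real.pi / (2 * B) * Real.sin (Real.pi / B * t)) ^ 2 =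
      Real.pi ^ 2 / B ^ 2 * (cosPrior B t * (1 - cosPrior B t)) := by
  rw [cosPrior_of_mem (Ioo_subset_Icc_self ht), mul_pow, Real.sin_sq]
  ring

theorem lipschitzWith_cosPrior (B : ℝ) : ∃ C, LipschitzWith C (cosPrior B) := by
  have h1 : LipschitzWith 1 fun t : ℝ => max (-B) (min t B) :=
    (LipschitzWith.id.min_const B).const_max (-B)
  have h2 := Real.lipschitzWith_cos.comp ((lipschitzWith_smul (Real.pi / B)).comp h1)
  have h3 := (lipschitzWith_smul (1 / 2 : ℝ)).comp ((LipschitzWith.const (1 : ℝ)).add h2)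
  have e : cosPrior B =
      fun t => (1 / 2 : ℝ) • (1 + Real.cos ((Real.pi / B) • max (-B) (min t B))) := by
    ext t
    simp only [cosPrior, smul_eq_mul]
    ring
  rw [e]
  exact ⟨_, h3⟩

theorem integral_cosPrior (hB : 0 < B) : ∫ t, cosPrior B t = B := by
  have h1 : cosPrior B = (Ioc (-B) B).indicator fun t => (1 + Real.cos (Real.pi / B * t)) / 2 := by
    ext t
    by_cases ht : t ∈ Ioc (-B) B
    · rw [indicator_of_mem ht, cosPrior_of_mem (Ioc_subset_Icc_self ht)]
    · rw [indicator_of_notMem ht, cosPrior_of_notMem hB fun h => ht (Ioo_subset_Ioc_self h)]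
  rw [h1, integral_indicator measurableSet_Ioc,
    ← intervalIntegral.integral_of_le (by linarith : -B ≤ B), intervalIntegral.integral_div,
    intervalIntegral.integral_add (by simp) (by
      apply Continuous.intervalIntegrable; fun_prop),
    intervalIntegral.integral_comp_mul_left (fun t => Real.cos t) (by positivity)]
  simp [div_mul_cancel₀ _ hB.ne']

variable {d : ℕ}

/-- The unnormalized product prior on the cube `[-B, B]^d`. -/
noncomputable def cubePrior (d : ℕ) (B : ℝ) (θ : EuclideanSpace ℝ (Fin d)) : ℝ :=
  ∏ i, cosPrior B (θ i)

/-- The product prior with the `j`-th factor replaced by the indicator of `[-B, B]`. -/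
noncomputable def flatPrior (B : ℝ) (j : Fin d) (θ : EuclideanSpace ℝ (Fin d)) : ℝ :=
  ∏ i, Function.update (fun _ => cosPrior B) j ((Icc (-B) B).indicator 1) i (θ i)

theorem flatPrior_eq (B : ℝ) (j : Fin d) (θ : EuclideanSpace ℝ (Fin d)) :
    flatPrior B j θ =
      (Icc (-B) B).indicator 1 (θ j) * ∏ i ∈ Finset.univ.erase j, cosPrior B (θ i) := by
  rw [flatPrior, ← Finset.mul_prod_erase _ _ (Finset.mem_univ j), Function.update_self]
  congr 1
  exact Finset.prod_congr rfl fun i hi => by rw [Function.update_of_ne (Finset.ne_of_mem_erase hi)]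

theorem cubePrior_eq (B : ℝ) (j : Fin d) (θ : EuclideanSpace ℝ (Fin d)) :
    cubePrior d B θ = cosPrior B (θ j) * ∏ i ∈ Finset.univ.erase j, cosPrior B (θ i) :=
  (Finset.mul_prod_erase _ _ (Finset.mem_univ j)).symm

theorem cubePrior_nonneg (B : ℝ) (θ : EuclideanSpace ℝ (Fin d)) : 0 ≤ cubePrior d B θ :=
  Finset.prod_nonneg fun _ _ => cosPrior_nonneg _ _

theorem flatPrior_nonneg (B : ℝ) (j : Fin d) (θ : EuclideanSpace ℝ (Fin d)) :
    0 ≤ flatPrior B j θ := by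
  rw [flatPrior_eq]
  exact mul_nonneg (indicator_nonneg (fun _ _ => zero_le_one) _)
    (Finset.prod_nonneg fun _ _ => cosPrior_nonneg _ _)

theorem cubePrior_of_notMem (hB : 0 < B) {θ : EuclideanSpace ℝ (Fin d)}
    (hθ : ¬ ∀ j, θ j ∈ Ioo (-B) B) : cubePrior d B θ = 0 := by
  push Not at hθ
  obtain ⟨j, hj⟩ := hθ
  exact Finset.prod_eq_zero (Finset.mem_univ j) (cosPrior_of_notMem hB hj)

theorem isCompact_cube (d : ℕ) (B : ℝ) : IsCompact (cube d B) := by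
  have h1 : IsCompact (univ.pi fun _ : Fin d => Icc (-B) B) := isCompact_univ_pi fun _ => isCompact_Icc
  have h2 := (PiLp.homeomorph 2 fun _ : Fin d => ℝ).isCompact_preimage.2 h1
  convert h2 using 1
  ext θ
  exact (mem_univ_pi (f := fun j => θ j)).symm

theorem hasCompactSupport_cubePrior (hB : 0 < B) : HasCompactSupport (cubePrior d B) :=
  HasCompactSupport.intro (isCompact_cube d B) fun _ hθ =>
    cubePrior_of_notMem hB fun h => hθ fun j => Ioo_subset_Icc_self (h j)

theorem lipschitzWith_eval (i : Fin d) :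
    LipschitzWith 1 fun θ : EuclideanSpace ℝ (Fin d) => θ i :=
  LipschitzWith.of_dist_le_mul fun θ η => by
    rw [NNReal.coe_one, one_mul, dist_eq_norm, dist_eq_norm]
    exact PiLp.norm_apply_le (θ - η) i

/-- Lipschitz continuity with compact support admits the prior as a test function for integration by
parts without boundary terms. -/
theorem lipschitzWith_cubePrior (d : ℕ) (B : ℝ) : ∃ C, LipschitzWith C (cubePrior d B) := by
  obtain ⟨C, hC⟩ := lipschitzWith_cosPrior B
  have key : ∀ s : Finset (Fin d), ∃ C', LipschitzWith C'
      fun θ : EuclideanSpace ℝ (Fin d) => ∏ i ∈ s, cosPrior B (θ i) := by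
    intro s
    induction s using Finset.induction_on with
    | empty => exact ⟨0, by simp⟩
    | insert a s ha ih =>
      obtain ⟨C', hC'⟩ := ih
      refine ⟨C + C', LipschitzWith.of_dist_le_mul fun θ η => ?_⟩
      have h1 := (hC.comp (lipschitzWith_eval a)).dist_le_mul θ η
      have h2 := hC'.dist_le_mul θ η
      simp only [Function.comp_apply, mul_one, Real.dist_eq] at h1 h2
      rw [Finset.prod_insert ha, Finset.prod_insert ha, Real.dist_eq]
      have b1 : |cosPrior B (η a)| ≤ 1 := by
        rw [abs_of_nonneg (cosPrior_nonneg _ _)]; exact cosPrior_le_one _ _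
      have b2 : |∏ i ∈ s, cosPrior B (θ i)| ≤ 1 := by
        rw [abs_of_nonneg (Finset.prod_nonneg fun _ _ => cosPrior_nonneg _ _)]
        exact Finset.prod_le_one (fun _ _ => cosPrior_nonneg _ _) fun _ _ => cosPrior_le_one _ _
      push_cast
      generalize cosPrior B (θ a) = x at *
      generalize cosPrior B (η a) = y at *
      generalize ∏ i ∈ s, cosPrior B (θ i) = u at *
      generalize ∏ i ∈ s, cosPrior B (η i) = v at *
      calc |x * u - y * v| = |(x - y) * u + y * (u - v)| := by ring_nf
        _ ≤ |x - y| * |u| + |y| * |u - v| := by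
          rw [← abs_mul, ← abs_mul]; exact abs_add_le _ _
        _ ≤ |x - y| * 1 + 1 * |u - v| := by gcongr
        _ ≤ _ := by linarith
  exact key Finset.univ

theorem integral_euclideanSpace_prod (f : Fin d → ℝ → ℝ) :
    ∫ θ : EuclideanSpace ℝ (Fin d), ∏ i, f i (θ i) = ∏ i, ∫ t, f i t := by
  rw [← integral_fintype_prod_volume_eq_prod]
  exact (PiLp.volume_preserving_ofLp (Fin d)).integral_comp
    (MeasurableEquiv.toLp 2 (Fin d → ℝ)).symm.measurableEmbedding
    (fun u : Fin d → ℝ => ∏ i, f i (u i))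

theorem integral_cubePrior (hB : 0 < B) :
    ∫ θ, cubePrior d B θ = B ^ d := by
  simp_rw [cubePrior]
  rw [integral_euclideanSpace_prod fun _ => cosPrior B]
  simp [integral_cosPrior hB]

theorem integral_flatPrior (hB : 0 < B) (j : Fin d) :
    ∫ θ, flatPrior B j θ = 2 * B ^ d := by
  simp_rw [flatPrior]
  rw [integral_euclideanSpace_prod, ← Finset.mul_prod_erase _ _ (Finset.mem_univ j),
    Function.update_self, Finset.prod_congr rfl (g := fun _ => B) fun i hi => by
      rw [Function.update_of_ne (Finset.ne_of_mem_erase hi), integral_cosPrior hB],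
    integral_indicator_one measurableSet_Icc]
  have h1 : B * ∏ _i ∈ Finset.univ.erase j, B = B ^ d := by
    rw [Finset.mul_prod_erase Finset.univ (fun _ => B) (Finset.mem_univ j)]; simp
  have h2 : (volume : Measure ℝ).real (Icc (-B) B) = 2 * B := by
    rw [measureReal_def, Real.volume_Icc, ENNReal.toReal_ofReal (by linarith)]; ring
  rw [h2, mul_assoc, h1]

theorem integrable_flatPrior (hB : 0 < B) (j : Fin d) : Integrable (flatPrior B j) := by
  -- A nonintegrable function has Bochner integral zero, whereas this integral is `2 B^d > 0`.
  by_contra h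
  have h1 := integral_flatPrior hB j
  rw [integral_undef h] at h1
  have := pow_pos hB d
  linarith

theorem lineDeriv_cubePrior_of_notMem (hB : 0 < B) {θ : EuclideanSpace ℝ (Fin d)}
    (hθ : ¬ ∀ j, θ j ∈ Ioo (-B) B) (v : EuclideanSpace ℝ (Fin d)) :
    lineDeriv ℝ (cubePrior d B) θ v = 0 := by
  refine IsLocalMin.deriv_eq_zero (f := fun t : ℝ => cubePrior d B (θ + t • v)) (.of_forall fun t => ?_)
  simp [cubePrior_of_notMem hB hθ, cubePrior_nonneg]

theorem lineDeriv_cubePrior_of_mem {θ : EuclideanSpace ℝ (Fin d)}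
    (hθ : ∀ j, θ j ∈ Ioo (-B) B) (j : Fin d) :
    lineDeriv ℝ (cubePrior d B) θ (-EuclideanSpace.single j 1) =
      Real.pi / (2 * B) * Real.sin (Real.pi / B * θ j) *
        ∏ i ∈ Finset.univ.erase j, cosPrior B (θ i) := by
  have h1 : HasDerivAt (fun t => cosPrior B (θ j + -t) *
      ∏ i ∈ Finset.univ.erase j, cosPrior B (θ i))
      (Real.pi / (2 * B) * Real.sin (Real.pi / B * θ j) *
        ∏ i ∈ Finset.univ.erase j, cosPrior B (θ i)) 0 := by
    refine HasDerivAt.mul_const ?_ _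
    have h2 : HasDerivAt (cosPrior B) (-(Real.pi / (2 * B) * Real.sin (Real.pi / B * θ j)))
      (θ j + -0) := by simpa using hasDerivAt_cosPrior (hθ j)
    have h3 := h2.comp (0 : ℝ) ((hasDerivAt_neg (0 : ℝ)).const_add (θ j))
    simpa using! h3
  refine HasLineDerivAt.lineDeriv (h1.congr_of_eventuallyEq (.of_forall fun t => ?_))
  simp only [cubePrior_eq B j]
  congr 1
  · simp
  · refine Finset.prod_congr rfl fun i hi => ?_
    simp [Finset.ne_of_mem_erase hi]

/-- Inside the cube the square of the left side is `4xy`, with `x` and `y` the two summands on the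
right, so AM–GM applies. Outside, the prior is zero, hence minimal, and its derivative vanishes. -/
theorem lineDeriv_cubePrior_mul_le (hB : 0 < B) {c : ℝ} (hc : 0 < c)
    {θ : EuclideanSpace ℝ (Fin d)} (j : Fin d) (φ : ℝ) :
    -(lineDeriv ℝ (cubePrior d B) θ (-EuclideanSpace.single j 1) * φ) ≤
      cubePrior d B θ * (φ ^ 2 / (2 * c)) +
        c / 2 * (Real.pi ^ 2 / B ^ 2) * (flatPrior B j θ - cubePrior d B θ) := by
  by_cases hθ : ∀ j, θ j ∈ Ioo (-B) B
  · rw [lineDeriv_cubePrior_of_mem hθ j, flatPrior_eq, cubePrior_eq B j,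
      indicator_of_mem (Ioo_subset_Icc_self (hθ j)), Pi.one_apply]
    have hπ : 0 ≤ ∏ i ∈ Finset.univ.erase j, cosPrior B (θ i) :=
      Finset.prod_nonneg fun _ _ => cosPrior_nonneg _ _
    have hsq := sq_deriv_cosPrior (hθ j)
    have h0 := cosPrior_nonneg B (θ j)
    have h1 := cosPrior_le_one B (θ j)
    generalize Real.pi / (2 * B) * Real.sin (Real.pi / B * θ j) = a at *
    generalize ∏ i ∈ Finset.univ.erase j, cosPrior B (θ i) = p at *
    generalize cosPrior B (θ j) = l at *
    have hκ : 0 ≤ Real.pi ^ 2 / B ^ 2 := by positivity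
    generalize Real.pi ^ 2 / B ^ 2 = κ at *
    have h2 : -(a * φ) ≤ l * (φ ^ 2 / (2 * c)) + c / 2 * κ * (1 - l) := by
      have h3 : 0 ≤ l * (φ ^ 2 / (2 * c)) + c / 2 * κ * (1 - l) :=
        add_nonneg (by positivity) (mul_nonneg (by positivity) (by linarith))
      refine (abs_le_of_sq_le_sq' (?_ : (-(a * φ)) ^ 2 ≤ _) h3).2
      have h4 : (-(a * φ)) ^ 2 = 4 * (l * (φ ^ 2 / (2 * c))) * (c / 2 * κ * (1 - l)) := by
        rw [neg_sq, mul_pow, hsq]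
        field_simp
        norm_num
      rw [h4]
      nlinarith [sq_nonneg (l * (φ ^ 2 / (2 * c)) - c / 2 * κ * (1 - l))]
    nlinarith
  · rw [lineDeriv_cubePrior_of_notMem hB hθ, cubePrior_of_notMem hB hθ, zero_mul, neg_zero,
      zero_mul, zero_add, sub_zero]
    exact mul_nonneg (by positivity) (flatPrior_nonneg _ _ _)

/-- The integrated form of the van Trees argument with the product `cos²` prior on the cube. -/
theorem natCast_le_of_ae_sum_lineDeriv_le (hB : 0 < B) {c D : ℝ} (hc : 0 < c)
    {b : Fin d → EuclideanSpace ℝ (Fin d) → ℝ} (hb : ∀ j, ∃ C, LipschitzWith C (b j))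
    (h : ∀ᵐ θ : EuclideanSpace ℝ (Fin d), (∀ j, θ j ∈ Ioo (-B) B) →
      ∑ j, (lineDeriv ℝ (b j) θ (EuclideanSpace.single j 1) + (b j θ - θ j) ^ 2 / (2 * c)) ≤ D) :
    d ≤ D + c / 2 * (d * (Real.pi ^ 2 / B ^ 2)) := by
  set κ := Real.pi ^ 2 / B ^ 2 with hκ
  set w := cubePrior d B with hw
  obtain ⟨Cw, hwL⟩ := lipschitzWith_cubePrior d B
  have hwc : HasCompactSupport w := hasCompactSupport_cubePrior hB
  have hwi : Integrable w := hwL.continuous.integrable_of_hasCompactSupport hwc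
  have hwint : ∫ θ, w θ = B ^ d := integral_cubePrior hB
  have hbw : ∀ j, Integrable fun θ => lineDeriv ℝ (b j) θ (EuclideanSpace.single j 1) * w θ := by
    intro j
    obtain ⟨C, hC⟩ := hb j
    exact MemLp.integrable_mul (p := ∞) (q := 1) (hC.memLp_lineDeriv _) (memLp_one_iff_integrable.2 hwi)
  have hwφ : ∀ j, Integrable fun θ =>
      lineDeriv ℝ w θ (-EuclideanSpace.single j 1) * (b j θ - θ j) := by
    intro j
    obtain ⟨C, hC⟩ := hb j
    have h1 : IntegrableOn (fun θ => lineDeriv ℝ w θ (-EuclideanSpace.single j 1)) (cube d B) :=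
      (hwL.locallyIntegrable_lineDeriv _).integrableOn_isCompact (isCompact_cube d B)
    have h2 := h1.mul_continuousOn
      (hC.continuous.sub (lipschitzWith_eval j).continuous).continuousOn (isCompact_cube d B)
    refine (integrableOn_iff_integrable_of_support_subset ?_).1 h2
    intro θ hθ
    by_contra hθ'
    refine hθ ?_
    simp only
    rw [lineDeriv_cubePrior_of_notMem hB fun h => hθ' fun j => Ioo_subset_Icc_self (h j), zero_mul]
  -- Integrating `∂_j (b_j - θ_j)` by parts against `w` leaves only the mass `B^d` of the prior. The
  -- minus sign of the formula is carried by the direction `-e_j`.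
  have hibp : ∀ j, ∫ θ, (lineDeriv ℝ (b j) θ (EuclideanSpace.single j 1) * w θ -
      lineDeriv ℝ w θ (-EuclideanSpace.single j 1) * (b j θ - θ j)) = B ^ d := by
    intro j
    obtain ⟨C, hC⟩ := hb j
    have h1 := (hC.sub (lipschitzWith_eval j)).integral_lineDeriv_mul_eq (μ := volume) hwL hwc
      (EuclideanSpace.single j 1)
    have h2 : ∫ θ, lineDeriv ℝ (fun θ => b j θ - θ j) θ (EuclideanSpace.single j 1) * w θ =
        ∫ θ, (lineDeriv ℝ (b j) θ (EuclideanSpace.single j 1) * w θ - w θ) := by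
      refine integral_congr_ae ?_
      filter_upwards [hC.ae_lineDifferentiableAt (μ := volume) (EuclideanSpace.single j 1)]
        with θ hθ
      have h3 : HasLineDerivAt ℝ (fun θ : EuclideanSpace ℝ (Fin d) => θ j) 1 θ
          (EuclideanSpace.single j 1) := by
        simpa [HasLineDerivAt] using (hasDerivAt_id (0 : ℝ)).const_add (θ j)
      have h5 : HasLineDerivAt ℝ (fun θ => b j θ - θ j)
          (lineDeriv ℝ (b j) θ (EuclideanSpace.single j 1) - 1) θ (EuclideanSpace.single j 1) :=
        hθ.hasLineDerivAt.sub h3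
      rw [h5.lineDeriv]
      ring
    have h4 : ∫ θ, lineDeriv ℝ (fun θ => b j θ - θ j) θ (EuclideanSpace.single j 1) * w θ =
      ∫ θ, lineDeriv ℝ w θ (-EuclideanSpace.single j 1) * (b j θ - θ j) := h1
    rw [integral_sub (hbw j) (hwφ j), ← h4, h2, integral_sub (hbw j) hwi, hwint]
    ring
  have hbφ : ∀ j, Integrable fun θ => lineDeriv ℝ (b j) θ (EuclideanSpace.single j 1) * w θ -
      lineDeriv ℝ w θ (-EuclideanSpace.single j 1) * (b j θ - θ j) := fun j => (hbw j).sub (hwφ j)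
  have hfw : ∀ j : Fin d, Integrable fun θ => flatPrior B j θ - w θ := fun j =>
    (integrable_flatPrior hB j).sub hwi
  -- The value equals the total mass of `w`, so the normalized prior has information exactly `π²/B²`
  -- per coordinate.
  have hfint : ∀ j : Fin d, ∫ θ, (flatPrior B j θ - w θ) = 2 * B ^ d - B ^ d := fun j => by
    rw [integral_sub (integrable_flatPrior hB j) hwi, integral_flatPrior hB, hwint]
  have hfi : Integrable fun θ => D * w θ + c / 2 * κ * ∑ j, (flatPrior B j θ - w θ) :=
    (hwi.const_mul D).add (Integrable.const_mul
      (integrable_finsetSum _ fun j _ => hfw j) _)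
  have hmain : ∫ θ, ∑ j, (lineDeriv ℝ (b j) θ (EuclideanSpace.single j 1) * w θ -
      lineDeriv ℝ w θ (-EuclideanSpace.single j 1) * (b j θ - θ j)) ≤
      ∫ θ, (D * w θ + c / 2 * κ * ∑ j, (flatPrior B j θ - w θ)) := by
    refine integral_mono_ae (integrable_finsetSum _ fun j _ => hbφ j) hfi ?_
    filter_upwards [h] with θ hθ
    have h1 : ∑ j, (lineDeriv ℝ (b j) θ (EuclideanSpace.single j 1) * w θ -
        lineDeriv ℝ w θ (-EuclideanSpace.single j 1) * (b j θ - θ j)) ≤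
        w θ * ∑ j, (lineDeriv ℝ (b j) θ (EuclideanSpace.single j 1) +
          (b j θ - θ j) ^ 2 / (2 * c)) + c / 2 * κ * ∑ j, (flatPrior B j θ - w θ) := by
      rw [Finset.mul_sum, Finset.mul_sum, ← Finset.sum_add_distrib]
      refine Finset.sum_le_sum fun j _ => ?_
      have := lineDeriv_cubePrior_mul_le hB hc (θ := θ) j (b j θ - θ j)
      simp only [hw, hκ]
      linarith
    refine h1.trans ?_
    rw [mul_comm D]
    by_cases hθB : ∀ j, θ j ∈ Ioo (-B) B
    · gcongr
      · exact cubePrior_nonneg B θ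
      · exact hθ hθB
    · rw [hw, cubePrior_of_notMem hB hθB, zero_mul, zero_mul]
  rw [integral_finsetSum _ fun j _ => hbφ j,
    Finset.sum_congr rfl fun j _ => hibp j,
    integral_add (hwi.const_mul D) (Integrable.const_mul
      (integrable_finsetSum _ fun j _ => hfw j) _),
    integral_const_mul, integral_const_mul,
    integral_finsetSum _ fun j _ => hfw j,
    Finset.sum_congr rfl fun j _ => hfint j, hwint] at hmain
  simp only [Finset.sum_const, Finset.card_univ, Fintype.card_fin, nsmul_eq_mul] at hmain
  have hpos : 0 < B ^ d := pow_pos hB d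
  refine le_of_mul_le_mul_right ?_ hpos
  linarith

end Prior

/-! ### Regular families: from the score to differentiability in total variation on the cube. -/

section Family

open Filter Topology Set

variable {X : Type*} [MeasurableSpace X]

theorem abs_integral_mul_le {μ : Measure X} {φ r : X → ℝ} {M : ℝ} (hM : ∀ x, |φ x| ≤ M)
    (hr : Integrable r μ) : |∫ x, r x * φ x ∂μ| ≤ M * (∫⁻ x, ‖r x‖ₑ ∂μ).toReal := by
  rw [← integral_norm_eq_lintegral_enorm hr.1, ← integral_const_mul]
  refine norm_integral_le_of_norm_le (f := fun x => r x * φ x) (hr.norm.const_mul M)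
    (.of_forall fun x => ?_)
  rw [norm_mul, mul_comm]
  exact mul_le_mul_of_nonneg_right (hM x) (norm_nonneg _)

variable {μ : Measure X} {d : ℕ} {B : ℝ} {p : EuclideanSpace ℝ (Fin d) → X → ℝ}

theorem IsRegularFamily.measurable_density {Θ : Set (EuclideanSpace ℝ (Fin d))}
    (hp : IsRegularFamily μ Θ p) (θ : EuclideanSpace ℝ (Fin d)) : Measurable (p θ) :=
  hp.measurable.comp measurable_prodMk_left

theorem IsRegularFamily.integrable {Θ : Set (EuclideanSpace ℝ (Fin d))}
    (hp : IsRegularFamily μ Θ p) {θ : EuclideanSpace ℝ (Fin d)} (hθ : θ ∈ Θ) :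
    Integrable (p θ) μ := by
  refine ⟨(hp.measurable_density θ).aestronglyMeasurable, ?_⟩
  have h := (hp.isProbabilityMeasure θ hθ).measure_univ
  rw [law, withDensity_apply _ MeasurableSet.univ, setLIntegral_univ] at h
  rw [hasFiniteIntegral_iff_ofReal (.of_forall (hp.nonneg θ hθ)), h]
  exact ENNReal.one_lt_top

theorem IsRegularFamily.integral_law {Θ : Set (EuclideanSpace ℝ (Fin d))}
    (hp : IsRegularFamily μ Θ p) {θ : EuclideanSpace ℝ (Fin d)} (hθ : θ ∈ Θ) (φ : X → ℝ) :
    ∫ x, φ x ∂(law μ p θ) = ∫ x, p θ x * φ x ∂μ := by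
  rw [law, integral_withDensity_eq_integral_toReal_smul
    (hp.measurable_density θ).ennreal_ofReal (.of_forall fun _ => ENNReal.ofReal_lt_top)]
  refine integral_congr_ae (.of_forall fun x => ?_)
  simp [ENNReal.toReal_ofReal (hp.nonneg θ hθ x)]

theorem IsRegularFamily.integrable_mul {Θ : Set (EuclideanSpace ℝ (Fin d))}
    (hp : IsRegularFamily μ Θ p) {θ : EuclideanSpace ℝ (Fin d)} (hθ : θ ∈ Θ) {φ : X → ℝ} {M : ℝ}
    (hφ : Measurable φ) (hM : ∀ x, |φ x| ≤ M) : Integrable (fun x => p θ x * φ x) μ :=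
  (hp.integrable hθ).mul_bdd (c := M) hφ.aestronglyMeasurable (.of_forall hM)

theorem IsRegularFamily.abs_integral_law_sub_le {Θ : Set (EuclideanSpace ℝ (Fin d))}
    (hp : IsRegularFamily μ Θ p) {θ η : EuclideanSpace ℝ (Fin d)} (hθ : θ ∈ Θ) (hη : η ∈ Θ)
    {φ : X → ℝ} {M : ℝ} (hφ : Measurable φ) (hM : ∀ x, |φ x| ≤ M) :
    |∫ x, φ x ∂(law μ p η) - ∫ x, φ x ∂(law μ p θ)| ≤
      M * (∫⁻ x, ‖p η x - p θ x‖ₑ ∂μ).toReal := by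
  rw [hp.integral_law hθ, hp.integral_law hη,
    ← integral_sub (hp.integrable_mul hη hφ hM) (hp.integrable_mul hθ hφ hM)]
  simp_rw [← sub_mul]
  exact abs_integral_mul_le hM ((hp.integrable hη).sub (hp.integrable hθ))

theorem IsRegularFamily.abs_slope_integral_law_sub_le {Θ : Set (EuclideanSpace ℝ (Fin d))}
    (hp : IsRegularFamily μ Θ p) {θ η : EuclideanSpace ℝ (Fin d)} (hθ : θ ∈ Θ) (hη : η ∈ Θ)
    {D s : X → ℝ} (hs : Integrable s (law μ p θ)) (hsD : ∀ᵐ x ∂μ, p θ x * s x = D x) {h : ℝ}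
    {φ : X → ℝ} {M : ℝ} (hφ : Measurable φ) (hM : ∀ x, |φ x| ≤ M) :
    |(∫ x, φ x ∂(law μ p η) - ∫ x, φ x ∂(law μ p θ)) / h - ∫ x, s x * φ x ∂(law μ p θ)| ≤
      M * (∫⁻ x, ‖(p η x - p θ x) / h - D x‖ₑ ∂μ).toReal := by
  have hDi : Integrable D μ := by
    rw [law, integrable_withDensity_iff_integrable_smul₀'
      (hp.measurable_density θ).ennreal_ofReal.aemeasurable
      (.of_forall fun _ => ENNReal.ofReal_lt_top)] at hs
    refine hs.congr ?_
    filter_upwards [hsD] with x hx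
    rw [ENNReal.toReal_ofReal (hp.nonneg θ hθ x), smul_eq_mul, hx]
  have e1 : ∫ x, s x * φ x ∂(law μ p θ) = ∫ x, D x * φ x ∂μ := by
    rw [hp.integral_law hθ]
    refine integral_congr_ae ?_
    filter_upwards [hsD] with x hx
    rw [← hx, mul_assoc]
  have hi := (hp.integrable_mul hη hφ hM).sub (hp.integrable_mul hθ hφ hM)
  have hi' : Integrable (fun x => (p η x * φ x - p θ x * φ x) / h) μ := hi.div_const h
  have hDφ : Integrable (fun x => D x * φ x) μ :=
    hDi.mul_bdd (c := M) hφ.aestronglyMeasurable (.of_forall hM)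
  rw [e1, hp.integral_law hθ, hp.integral_law hη,
    ← integral_sub (hp.integrable_mul hη hφ hM) (hp.integrable_mul hθ hφ hM),
    ← integral_div, ← integral_sub hi' hDφ]
  have e2 : ∀ x, (p η x * φ x - p θ x * φ x) / h - D x * φ x =
    ((p η x - p θ x) / h - D x) * φ x := fun x => by ring
  simp_rw [e2]
  exact abs_integral_mul_le hM ((((hp.integrable hη).sub (hp.integrable hθ)).div_const h).sub hDi)

theorem add_smul_single_mem_cube {θ : EuclideanSpace ℝ (Fin d)} (hθ : θ ∈ cube d B) {j : Fin d}
    {t : ℝ} (ht : θ j + t ∈ Icc (-B) B) : θ + t • EuclideanSpace.single j (1 : ℝ) ∈ cube d B := by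
  intro i
  by_cases hi : i = j
  · subst hi; simpa using ht
  · simpa [hi] using hθ i

theorem preimage_line_cube_mem_nhds {θ : EuclideanSpace ℝ (Fin d)} (hθ : θ ∈ cube d B) {j : Fin d}
    (hj : θ j ∈ Ioo (-B) B) :
    (fun t : ℝ => θ + t • EuclideanSpace.single j (1 : ℝ)) ⁻¹' cube d B ∈ 𝓝 (0 : ℝ) := by
  have h1 : Tendsto (fun t : ℝ => θ j + t) (𝓝 0) (𝓝 (θ j)) := by
    have h2 : Continuous fun t : ℝ => θ j + t := by fun_prop
    simpa using h2.tendsto 0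
  filter_upwards [h1 (Icc_mem_nhds hj.1 hj.2)] with t ht using add_smul_single_mem_cube hθ ht

theorem IsRegularFamily.ae_score_eq (hp : IsRegularFamily μ (cube d B) p)
    {θ : EuclideanSpace ℝ (Fin d)} (hθ : θ ∈ cube d B) {j : Fin d} (hj : θ j ∈ Ioo (-B) B) :
    ∀ᵐ x ∂μ, p θ x ≠ 0 →
      score (cube d B) p θ j x = slopeLim (EuclideanSpace.single j (1 : ℝ)) p θ x / p θ x := by
  have h := hp.differentiable θ hθ j
  rw [law, ae_withDensity_iff (hp.measurable_density θ).ennreal_ofReal] at h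
  filter_upwards [h] with x hx hx0
  have hpos : 0 < p θ x := lt_of_le_of_ne (hp.nonneg θ hθ x) hx0.symm
  have hnhds := preimage_line_cube_mem_nhds hθ hj
  have hd : DifferentiableAt ℝ (fun t : ℝ => p (θ + t • EuclideanSpace.single j (1 : ℝ)) x) 0 :=
    DifferentiableWithinAt.differentiableAt (hx (by simpa using hpos)) hnhds
  have h1 := slopeLim_eq_of_hasDerivAt (f := fun t => p (θ + t • EuclideanSpace.single j (1 : ℝ)))
    hd.hasDerivAt
  rw [slopeLim_line, zero_smul, add_zero] at h1
  rw [score, lineDerivWithin, derivWithin_of_mem_nhds hnhds, h1]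
  have h2 := (hd.hasDerivAt.log (by simpa using hx0)).deriv
  rw [h2]
  simp

theorem IsRegularFamily.integrable_score_sq {Θ : Set (EuclideanSpace ℝ (Fin d))}
    (hp : IsRegularFamily μ Θ p)
    {θ : EuclideanSpace ℝ (Fin d)} (hθ : θ ∈ Θ) (j : Fin d) :
    Integrable (fun x => score Θ p θ j x ^ 2) (law μ p θ) :=
  (hp.memLp_score θ hθ j).integrable_sq

theorem fisherInfo_diag (Θ : Set (EuclideanSpace ℝ (Fin d))) (θ : EuclideanSpace ℝ (Fin d))
    (j : Fin d) : fisherInfo μ Θ p θ j j = ∫ x, score Θ p θ j x ^ 2 ∂(law μ p θ) := by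
  simp [fisherInfo, sq]

theorem fisherInfo_diag_nonneg (Θ : Set (EuclideanSpace ℝ (Fin d)))
    (θ : EuclideanSpace ℝ (Fin d)) (j : Fin d) : 0 ≤ fisherInfo μ Θ p θ j j := by
  rw [fisherInfo_diag]
  exact integral_nonneg fun x => sq_nonneg _

/-- Where the density is nonzero the derivative is density times score, so its `L¹` norm is at most
`E|s| ≤ 1 + E s²`. -/
theorem IsRegularFamily.lintegral_slopeLim_le (hp : IsRegularFamily μ (cube d B) p)
    {θ : EuclideanSpace ℝ (Fin d)} (hθ : θ ∈ cube d B) {j : Fin d} (hj : θ j ∈ Ioo (-B) B) :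
    ∫⁻ x in {x | p θ x ≠ 0}, ‖slopeLim (EuclideanSpace.single j (1 : ℝ)) p θ x‖ₑ ∂μ ≤
      1 + ENNReal.ofReal (fisherInfo μ (cube d B) p θ).trace := by
  have := hp.isProbabilityMeasure θ hθ
  have hms : MeasurableSet {x | p θ x ≠ 0} :=
    (hp.measurable_density θ) (measurableSet_singleton 0).compl
  have hsc := (hp.memLp_score θ hθ j).1
  calc ∫⁻ x in {x | p θ x ≠ 0}, ‖slopeLim (EuclideanSpace.single j (1 : ℝ)) p θ x‖ₑ ∂μ
      ≤ ∫⁻ x in {x | p θ x ≠ 0}, ENNReal.ofReal (p θ x) * ‖score (cube d B) p θ j x‖ₑ ∂μ := by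
        refine lintegral_mono_ae ?_
        filter_upwards [ae_restrict_of_ae (hp.ae_score_eq hθ hj), ae_restrict_mem hms]
          with x hx hx0
        rw [← Real.enorm_of_nonneg (hp.nonneg θ hθ x), ← enorm_mul, hx hx0,
          mul_div_cancel₀ _ hx0]
    _ ≤ ∫⁻ x, ENNReal.ofReal (p θ x) * ‖score (cube d B) p θ j x‖ₑ ∂μ := setLIntegral_le_lintegral _ _
    _ = ∫⁻ x, ‖score (cube d B) p θ j x‖ₑ ∂(law μ p θ) := by
        rw [law, lintegral_withDensity_eq_lintegral_mul₀'
          (hp.measurable_density θ).ennreal_ofReal.aemeasurable hsc.enorm]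
        rfl
    _ ≤ ∫⁻ x, (1 + ENNReal.ofReal (score (cube d B) p θ j x ^ 2)) ∂(law μ p θ) := by
        refine lintegral_mono fun x => ?_
        rw [← ENNReal.ofReal_one, ← ENNReal.ofReal_add zero_le_one (sq_nonneg _),
          Real.enorm_eq_ofReal_abs]
        refine ENNReal.ofReal_le_ofReal ?_
        nlinarith [sq_abs (score (cube d B) p θ j x), sq_nonneg (|score (cube d B) p θ j x| - 1),
          abs_nonneg (score (cube d B) p θ j x)]
    _ = 1 + ENNReal.ofReal (fisherInfo μ (cube d B) p θ j j) := by
        rw [lintegral_add_left measurable_const, fisherInfo_diag,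
          ofReal_integral_eq_lintegral_ofReal (hp.integrable_score_sq hθ j)
            (.of_forall fun x => sq_nonneg _)]
        simp
    _ ≤ _ := by
        gcongr
        exact Finset.single_le_sum (f := fun j => fisherInfo μ (cube d B) p θ j j)
          (fun i _ => fisherInfo_diag_nonneg _ _ i) (Finset.mem_univ j)

section Bounded

variable {S : ℝ≥0∞}

theorem IsRegularFamily.lintegral_slopeLim_line_le (hp : IsRegularFamily μ (cube d B) p)
    (hS : ∀ θ ∈ cube d B, ENNReal.ofReal (fisherInfo μ (cube d B) p θ).trace ≤ S)
    {θ : EuclideanSpace ℝ (Fin d)} (hθ : θ ∈ cube d B) {j : Fin d} (hj : θ j = -B)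
    {t : ℝ} (ht : t ∈ Ioo 0 (2 * B)) :
    ∫⁻ x in {x | p (θ + t • EuclideanSpace.single j (1 : ℝ)) x ≠ 0},
      ‖slopeLim (1 : ℝ) (fun t => p (θ + t • EuclideanSpace.single j (1 : ℝ))) t x‖ₑ ∂μ ≤
        1 + S := by
  have hmem : θ + t • EuclideanSpace.single j (1 : ℝ) ∈ cube d B :=
    add_smul_single_mem_cube hθ (by rw [hj]; constructor <;> linarith [ht.1, ht.2])
  simp_rw [slopeLim_line]
  refine (hp.lintegral_slopeLim_le hmem (j := j) ?_).trans (by gcongr; exact hS _ hmem)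
  simp [hj]
  constructor <;> linarith [ht.1, ht.2]

theorem measurable_line (hp : Measurable fun q : EuclideanSpace ℝ (Fin d) × X => p q.1 q.2)
    (θ v : EuclideanSpace ℝ (Fin d)) : Measurable fun q : ℝ × X => p (θ + q.1 • v) q.2 :=
  hp.comp (((measurable_fst.smul_const v).const_add θ).prodMk measurable_snd)

theorem line_mem_cube {θ : EuclideanSpace ℝ (Fin d)} (hθ : θ ∈ cube d B) {j : Fin d}
    (hj : θ j = -B) {t : ℝ} (ht : t ∈ Icc 0 (2 * B)) :
    θ + t • EuclideanSpace.single j (1 : ℝ) ∈ cube d B :=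
  add_smul_single_mem_cube hθ (by rw [hj]; constructor <;> linarith [ht.1, ht.2])

variable [SigmaFinite μ]

theorem IsRegularFamily.lintegral_enorm_sub_le (hp : IsRegularFamily μ (cube d B) p) (hB : 0 < B)
    (hS : ∀ θ ∈ cube d B, ENNReal.ofReal (fisherInfo μ (cube d B) p θ).trace ≤ S)
    {θ η : EuclideanSpace ℝ (Fin d)} (hθ : θ ∈ cube d B) (hη : η ∈ cube d B) {j : Fin d}
    (hij : ∀ i, i ≠ j → η i = θ i) (hle : θ j ≤ η j) :
    ∫⁻ x, ‖p η x - p θ x‖ₑ ∂μ ≤ (1 + S) * ENNReal.ofReal (η j - θ j) := by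
  set β := θ + (-B - θ j) • EuclideanSpace.single j (1 : ℝ) with hβ
  have hβj : β j = -B := by simp [hβ]
  have hβmem : β ∈ cube d B := add_smul_single_mem_cube hθ (by simp; linarith)
  have e1 : β + (θ j + B) • EuclideanSpace.single j (1 : ℝ) = θ := by
    rw [hβ, add_assoc, ← add_smul, show -B - θ j + (θ j + B) = 0 by ring, zero_smul, add_zero]
  have e2 : β + (η j + B) • EuclideanSpace.single j (1 : ℝ) = η := by
    rw [hβ, add_assoc, ← add_smul]
    ext i
    by_cases hi : i = j
    · subst hi; simp; ring
    · simp [hi, hij i hi]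
  have h := lintegral_enorm_sub_le_mul (μ := μ) (S := 2 * B)
    (f := fun t => p (β + t • EuclideanSpace.single j (1 : ℝ)))
    (measurable_line hp.measurable _ _)
    (fun t ht => hp.nonneg _ (line_mem_cube hβmem hβj ht))
    (hp.absolutelyContinuous β hβmem j (2 * B) (by linarith)
      fun t ht => line_mem_cube hβmem hβj ht)
    (fun t ht => hp.lintegral_slopeLim_line_le hS hβmem hβj ht)
    (a := θ j + B) (b := η j + B) (by linarith [(hθ j).1]) (by linarith) (by linarith [(hη j).2])
  simp only [e1, e2] at h
  simpa using h

theorem IsRegularFamily.ae_tendsto_slopeSeq (hp : IsRegularFamily μ (cube d B) p) (hB : 0 < B)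
    (hStop : S ≠ ∞)
    (hS : ∀ θ ∈ cube d B, ENNReal.ofReal (fisherInfo μ (cube d B) p θ).trace ≤ S) (j : Fin d) :
    ∀ᵐ θ : EuclideanSpace ℝ (Fin d), (∀ i, θ i ∈ Ioo (-B) B) →
      Tendsto (fun k => ∫⁻ x, ‖slopeSeq (EuclideanSpace.single j (1 : ℝ)) p k θ x -
        slopeLim (EuclideanSpace.single j (1 : ℝ)) p θ x‖ₑ ∂μ) atTop (𝓝 0) ∧
      ∀ᵐ x ∂μ, p θ x = 0 → slopeLim (EuclideanSpace.single j (1 : ℝ)) p θ x = 0 := by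
  set v := EuclideanSpace.single j (1 : ℝ) with hv
  have hDm := measurable_slopeLim v hp.measurable
  have hqm := measurable_slopeSeq v hp.measurable
  set G : Set (EuclideanSpace ℝ (Fin d)) := {θ | (∀ i, θ i ∈ Ioo (-B) B) →
    Tendsto (fun k => ∫⁻ x, ‖slopeSeq v p k θ x - slopeLim v p θ x‖ₑ ∂μ) atTop (𝓝 0) ∧
      ∀ᵐ x ∂μ, p θ x = 0 → slopeLim v p θ x = 0} with hG
  have hGm : MeasurableSet G := by
    refine MeasurableSet.imp ?_ (MeasurableSet.inter ?_ ?_)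
    · have : {θ : EuclideanSpace ℝ (Fin d) | ∀ i, θ i ∈ Ioo (-B) B} =
        ⋂ i, (fun θ : EuclideanSpace ℝ (Fin d) => θ i) ⁻¹' Ioo (-B) B := by ext; simp
      exact this ▸ MeasurableSet.iInter fun i =>
        (lipschitzWith_eval i).continuous.measurable measurableSet_Ioo
    · exact measurableSet_tendsto _ fun k => ((hqm k).sub hDm).enorm.lintegral_prod_right'
    · have hms : MeasurableSet {q : EuclideanSpace ℝ (Fin d) × X |
          ¬ (p q.1 q.2 = 0 → slopeLim v p q.1 q.2 = 0)} :=
        (MeasurableSet.imp (hp.measurable (measurableSet_singleton 0))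
          (hDm (measurableSet_singleton 0))).compl
      exact measurable_measure_prodMk_left hms (measurableSet_singleton 0)
  -- By Fubini it suffices to treat almost every point of each line in direction `v`. Lines that
  -- miss the open cube are vacuous; the others are parametrized from their entry point `β` on the
  -- face where coordinate `j` is `-B`.
  refine ae_mem_of_ae_add_linearMap_mem (LinearMap.toSpanSingleton ℝ _ v) volume volume hGm ?_
  intro y
  simp only [LinearMap.toSpanSingleton_apply]
  by_cases hy : ∀ i, i ≠ j → y i ∈ Ioo (-B) B
  swap
  · refine .of_forall fun t h => absurd (fun i hi => ?_) hy
    simpa [hv, hi] using h i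
  set β := y + (-B - y j) • v with hβ
  have hβj : β j = -B := by simp [hβ, hv]
  have hβmem : β ∈ cube d B := by
    intro i
    by_cases hi : i = j
    · rw [hi, hβj]; constructor <;> linarith
    · simpa [hβ, hv, hi] using Ioo_subset_Icc_self (hy i hi)
  have hline := measurable_line hp.measurable β v
  have hpos : ∀ t ∈ Icc 0 (2 * B), ∀ x, 0 ≤ p (β + t • v) x :=
    fun t ht => hp.nonneg _ (line_mem_cube hβmem hβj ht)
  have hac := hp.absolutelyContinuous β hβmem j (2 * B) (by linarith)
      fun t ht => line_mem_cube hβmem hβj ht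
  have h1 := ae_tendsto_lintegral_slopeSeq_sub (μ := μ) hline hpos hac
    (ENNReal.add_ne_top.2 ⟨ENNReal.one_ne_top, hStop⟩)
    (fun t ht => hp.lintegral_slopeLim_line_le hS hβmem hβj ht)
  have h2 := ae_ae_tendsto_slopeSeq (μ := μ) hline hpos hac
  have h3 := (measurePreserving_add_right (volume : Measure ℝ)
    (y j + B)).quasiMeasurePreserving.ae (h1.and h2)
  filter_upwards [h3] with t ht hmem
  have e : β + (t + (y j + B)) • v = y + t • v := by
    rw [hβ, add_assoc, ← add_smul]; congr 2; ring
  have htm : t + (y j + B) ∈ Ioo 0 (2 * B) := by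
    have := hmem j
    simp [hv] at this
    constructor <;> linarith [this.1, this.2]
  obtain ⟨h4, h5⟩ := ht
  have h6 := h4 htm
  simp_rw [slopeSeq_line, slopeLim_line, e] at h6
  refine ⟨h6, ?_⟩
  filter_upwards [h5] with x hx
  have h7 := (hx htm).2
  rwa [slopeLim_line, e] at h7

end Bounded

end Family

/-! ### The information bound for the outputs, the risk bound and the uninformative case. -/

section VanTrees

open Filter Topology Set

variable {X Z : Type*} [MeasurableSpace X] [MeasurableSpace Z] {μ : Measure X} {d : ℕ} {B : ℝ}
  {p : EuclideanSpace ℝ (Fin d) → X → ℝ}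

/-- The mean of `g` under the output law with parameter `θ`. -/
noncomputable def outputMean (μ : Measure X) (p : EuclideanSpace ℝ (Fin d) → X → ℝ) {n : ℕ}
    (K : SeqProtocol X Z n) (g : (Fin n → Z) → ℝ) (θ : EuclideanSpace ℝ (Fin d)) : ℝ :=
  ∫ z, g z ∂(outputLaw (law μ p θ) n K)

/-- Coordinates are changed one at a time. The intermediate points stay in the cube, and regularity
is only assumed along the axes. -/
theorem lipschitzOnWith_cube_of_coordinatewise {b : EuclideanSpace ℝ (Fin d) → ℝ} {L : ℝ}
    (hL : 0 ≤ L)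
    (h : ∀ θ ∈ cube d B, ∀ η ∈ cube d B, ∀ j, (∀ i, i ≠ j → η i = θ i) →
      |b η - b θ| ≤ L * |η j - θ j|) :
    LipschitzOnWith (L * d).toNNReal b (cube d B) := by
  refine LipschitzOnWith.of_dist_le_mul fun η hη θ hθ => ?_
  rw [Real.coe_toNNReal _ (by positivity), Real.dist_eq, dist_eq_norm]
  set w : Finset (Fin d) → EuclideanSpace ℝ (Fin d) :=
    fun s => WithLp.toLp 2 fun i => if i ∈ s then η i else θ i with hw
  have hwi : ∀ s i, w s i = if i ∈ s then η i else θ i := fun s i => rfl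
  have hmem : ∀ s, w s ∈ cube d B := fun s i => by
    rw [hwi]
    split_ifs
    · exact hη i
    · exact hθ i
  have key : ∀ s : Finset (Fin d), |b (w s) - b θ| ≤ ∑ i ∈ s, L * |η i - θ i| := by
    intro s
    induction s using Finset.induction_on with
    | empty =>
      have : w ∅ = θ := by ext i; simp [hwi]
      simp [this]
    | insert a s ha ih =>
      rw [Finset.sum_insert ha]
      have h1 := h (w s) (hmem s) (w (insert a s)) (hmem _) a fun i hi => by
        simp [hwi, hi]
      rw [hwi, hwi, if_pos (Finset.mem_insert_self a s), if_neg ha] at h1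
      exact (abs_sub_le _ _ _).trans (add_le_add h1 ih)
  have huniv : w Finset.univ = η := by ext i; simp [hwi]
  have h2 := key Finset.univ
  rw [huniv] at h2
  refine h2.trans ?_
  calc ∑ i, L * |η i - θ i| ≤ ∑ _i : Fin d, L * ‖η - θ‖ :=
        Finset.sum_le_sum fun i _ => mul_le_mul_of_nonneg_left (PiLp.norm_apply_le (η - θ) i) hL
    _ = L * d * ‖η - θ‖ := by simp; ring

section Bounded

variable [SigmaFinite μ] {S : ℝ≥0∞}

theorem IsRegularFamily.abs_outputMean_sub_le (hp : IsRegularFamily μ (cube d B) p) (hB : 0 < B)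
    (hStop : S ≠ ∞)
    (hS : ∀ θ ∈ cube d B, ENNReal.ofReal (fisherInfo μ (cube d B) p θ).trace ≤ S) {n : ℕ}
    {K : SeqProtocol X Z n} (hK : ∀ i, IsMarkovKernel (K i)) {g : (Fin n → Z) → ℝ}
    (hg : Measurable g) {M : ℝ} (hM0 : 0 ≤ M) (hM : ∀ z, |g z| ≤ M)
    {θ η : EuclideanSpace ℝ (Fin d)} (hθ : θ ∈ cube d B) (hη : η ∈ cube d B) {j : Fin d}
    (hij : ∀ i, i ≠ j → η i = θ i) :
    |outputMean μ p K g η - outputMean μ p K g θ| ≤ n * M * (1 + S).toReal * |η j - θ j| := by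
  wlog hle : θ j ≤ η j generalizing θ η
  · rw [abs_sub_comm, abs_sub_comm (η j)]
    exact this hη hθ (fun i hi => (hij i hi).symm) (le_of_not_ge hle)
  have := hp.isProbabilityMeasure θ hθ
  have := hp.isProbabilityMeasure η hη
  have hStop' : 1 + S ≠ ∞ := ENNReal.add_ne_top.2 ⟨ENNReal.one_ne_top, hStop⟩
  have h1 := ENNReal.toReal_mono (ENNReal.mul_ne_top hStop' ENNReal.ofReal_ne_top)
    (hp.lintegral_enorm_sub_le hB hS hθ hη hij hle)
  rw [ENNReal.toReal_mul, ENNReal.toReal_ofReal (sub_nonneg.2 hle)] at h1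
  have h2 := abs_integral_outputLaw_sub_le (P := law μ p θ) (P' := law μ p η)
    (τ := (∫⁻ x, ‖p η x - p θ x‖ₑ ∂μ).toReal)
    (fun φ M hφ hM => hp.abs_integral_law_sub_le hθ hη hφ hM) n K hK g M hg hM
  rw [abs_of_nonneg (sub_nonneg.2 hle)]
  calc _ ≤ _ := h2
    _ ≤ n * (M * ((1 + S).toReal * (η j - θ j))) := by gcongr
    _ = _ := by ring

/-- The Fisher information bound for the output law, at almost every parameter. -/
theorem IsRegularFamily.ae_sq_lineDeriv_le (hp : IsRegularFamily μ (cube d B) p) (hB : 0 < B)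
    (hStop : S ≠ ∞)
    (hS : ∀ θ ∈ cube d B, ENNReal.ofReal (fisherInfo μ (cube d B) p θ).trace ≤ S)
    {ε : ℝ} (hε : 0 < ε) {n : ℕ} {K : SeqProtocol X Z n} (hK : K.IsPrivate ε)
    {g : (Fin n → Z) → ℝ} (hg : Measurable g) {M : ℝ} (hM : ∀ z, |g z| ≤ M)
    {b : EuclideanSpace ℝ (Fin d) → ℝ} {C : NNReal} (hb : LipschitzWith C b)
    (hbg : ∀ θ ∈ cube d B, b θ = outputMean μ p K g θ) (j : Fin d) :
    ∀ᵐ θ : EuclideanSpace ℝ (Fin d), (∀ i, θ i ∈ Ioo (-B) B) →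
      lineDeriv ℝ b θ (EuclideanSpace.single j 1) ^ 2 ≤
        n * (upsilon ε * fisherInfo μ (cube d B) p θ j j) *
          (outputMean μ p K (fun z => g z ^ 2) θ - outputMean μ p K g θ ^ 2) := by
  set v := EuclideanSpace.single j (1 : ℝ) with hv
  filter_upwards [hp.ae_tendsto_slopeSeq hB hStop hS j, hb.ae_lineDifferentiableAt (μ := volume) v]
    with θ hθ hdiff hθB
  obtain ⟨hlim, hzero⟩ := hθ hθB
  have hθmem : θ ∈ cube d B := fun i => Ioo_subset_Icc_self (hθB i)
  have hP := hp.isProbabilityMeasure θ hθmem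
  -- Shifting the sequence by `k₀` keeps every perturbed parameter in the cube, where the laws are
  -- probability measures.
  obtain ⟨k₀, hk₀⟩ : ∃ k₀, ∀ k ≥ k₀, θ + step k • v ∈ cube d B := by
    have h1 := tendsto_step (preimage_line_cube_mem_nhds hθmem (hθB j))
    exact eventually_atTop.1 h1
  have hmem : ∀ k, θ + step (k + k₀) • v ∈ cube d B := fun k => hk₀ _ (Nat.le_add_left _ _)
  have hPk := fun k => hp.isProbabilityMeasure _ (hmem k)
  have hstep : Tendsto (fun k => step (k + k₀)) atTop (𝓝 0) :=
    tendsto_step.comp (tendsto_add_atTop_nat k₀)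
  have hδ : Tendsto (fun k => (∫⁻ x, ‖slopeSeq v p (k + k₀) θ x - slopeLim v p θ x‖ₑ ∂μ).toReal)
      atTop (𝓝 0) := by
    have := (ENNReal.tendsto_toReal ENNReal.zero_ne_top).comp
      (hlim.comp (tendsto_add_atTop_nat k₀))
    simpa using! this
  set s : X → ℝ := fun x => slopeLim v p θ x / p θ x with hs
  have hsm : Measurable s :=
    (measurable_slopeLim_right v hp.measurable θ).div (hp.measurable_density θ)
  have hsc : score (cube d B) p θ j =ᵐ[law μ p θ] s := by
    rw [Filter.EventuallyEq, law, ae_withDensity_iff (hp.measurable_density θ).ennreal_ofReal]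
    filter_upwards [hp.ae_score_eq hθmem (hθB j)] with x hx hx0
    exact hx fun h => hx0 (by simp [h])
  have hsL : MemLp s 2 (law μ p θ) := (memLp_congr_ae hsc).1 (hp.memLp_score θ hθmem j)
  have hsD : ∀ᵐ x ∂μ, p θ x * s x = slopeLim v p θ x := by
    filter_upwards [hzero] with x hx
    by_cases h0 : p θ x = 0
    · rw [h0, zero_mul]; exact (hx h0).symm
    · simp only [hs]
      field_simp
  have hI : ∫ x, s x ^ 2 ∂(law μ p θ) = fisherInfo μ (cube d B) p θ j j := by
    rw [fisherInfo_diag]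
    refine integral_congr_ae ?_
    filter_upwards [hsc] with x hx
    rw [hx]
  obtain ⟨L, hL, hL2⟩ := exists_tendsto_slope_outputLaw hε (P := law μ p θ)
    (Pk := fun k => law μ p (θ + step (k + k₀) • v)) hstep (fun k => (step_pos _).ne') hδ hsm hsL
    (fun k φ M hφ hM => hp.abs_slope_integral_law_sub_le hθmem (hmem k)
      (hsL.integrable (by norm_num)) hsD hφ hM) n K hK g M hg hM
  have hL' : Tendsto (fun k => (step (k + k₀))⁻¹ • (b (θ + step (k + k₀) • v) - b θ)) atTop
      (𝓝 (lineDeriv ℝ b θ v)) := by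
    have h1 : Tendsto (fun k => step (k + k₀)) atTop (𝓝[>] 0) :=
      tendsto_nhdsWithin_iff.2 ⟨hstep, .of_forall fun k => step_pos _⟩
    exact hdiff.hasLineDerivAt.tendsto_slope_zero_right.comp h1
  have hEq : lineDeriv ℝ b θ v = L := by
    refine tendsto_nhds_unique hL' (hL.congr fun k => ?_)
    rw [hbg _ (hmem k), hbg _ hθmem, smul_eq_mul, div_eq_inv_mul]
    rfl
  rw [hI] at hL2
  rw [hEq]
  exact hL2

/-- AM–GM with weight `c`: the information inequality becomes linear in the variance `V`, which then
combines with the squared bias into the risk. -/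
theorem le_add_of_sq_le {l c J V : ℝ} (hc : 0 < c) (hJ : 0 ≤ J) (hV : 0 ≤ V)
    (h : l ^ 2 ≤ J * V) : l ≤ V / (2 * c) + c / 2 * J := by
  have h0 : 0 ≤ V / (2 * c) + c / 2 * J := by positivity
  refine (abs_le_of_sq_le_sq' ?_ h0).2
  have h1 : J * V = 4 * (V / (2 * c)) * (c / 2 * J) := by
    field_simp
    norm_num
  nlinarith [sq_nonneg (V / (2 * c) - c / 2 * J)]

/-- Real-valued form of the private van Trees inequality for estimators with values in the cube. -/
theorem IsRegularFamily.sq_le_risk_mul (hp : IsRegularFamily μ (cube d B) p) (hB : 0 < B)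
    (hStop : S ≠ ∞)
    (hS : ∀ θ ∈ cube d B, ENNReal.ofReal (fisherInfo μ (cube d B) p θ).trace ≤ S)
    {ε : ℝ} (hε : 0 < ε) {n : ℕ} {K : SeqProtocol X Z n} (hK : K.IsPrivate ε)
    {g : Fin d → (Fin n → Z) → ℝ} (hg : ∀ j, Measurable (g j)) (hgB : ∀ j z, |g j z| ≤ B)
    {R : ℝ} (hR : ∀ θ ∈ cube d B,
      ∑ j, ∫ z, (g j z - θ j) ^ 2 ∂(outputLaw (law μ p θ) n K) ≤ R) :
    (d : ℝ) ^ 2 ≤ R * (n * upsilon ε * S.toReal + d * Real.pi ^ 2 / B ^ 2) := by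
  have hK' : ∀ i, IsMarkovKernel (K i) := fun i => (hK i).1
  -- For `d = 0` the weight `d / A` chosen below would not be positive.
  obtain rfl | hd := Nat.eq_zero_or_pos d
  · have h0 : 0 ≤ R := by simpa using hR 0 (fun j => j.elim0)
    have := upsilon_nonneg ε
    simp only [Nat.cast_zero, ne_eq, OfNat.ofNat_ne_zero, not_false_eq_true, zero_pow, zero_mul,
      zero_div, add_zero]
    positivity
  have hext : ∀ j, ∃ b : EuclideanSpace ℝ (Fin d) → ℝ, (∃ C, LipschitzWith C b) ∧
      EqOn (outputMean μ p K (g j)) b (cube d B) := fun j => by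
    have h1 : LipschitzOnWith (n * B * (1 + S).toReal * d).toNNReal (outputMean μ p K (g j))
        (cube d B) := lipschitzOnWith_cube_of_coordinatewise (by positivity)
      fun θ hθ η hη i hi => hp.abs_outputMean_sub_le hB hStop hS hK' (hg j) hB.le (hgB j) hθ hη hi
    -- The mean is controlled only on the cube, while the integration by parts takes place on the
    -- whole space.
    obtain ⟨b, hb, hbe⟩ := h1.extend_real
    exact ⟨b, ⟨_, hb⟩, hbe⟩
  choose b hb hbe using hext
  have hderiv : ∀ᵐ θ : EuclideanSpace ℝ (Fin d), ∀ j, (∀ i, θ i ∈ Ioo (-B) B) →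
      lineDeriv ℝ (b j) θ (EuclideanSpace.single j 1) ^ 2 ≤
        n * (upsilon ε * fisherInfo μ (cube d B) p θ j j) *
          (outputMean μ p K (fun z => g j z ^ 2) θ - outputMean μ p K (g j) θ ^ 2) := by
    refine ae_all_iff.2 fun j => ?_
    obtain ⟨C, hC⟩ := hb j
    exact hp.ae_sq_lineDeriv_le hB hStop hS hε hK (hg j) (hgB j) hC (fun θ hθ => (hbe j hθ).symm) j
  have hmain : ∀ c : ℝ, 0 < c → (d : ℝ) ≤
      (R / (2 * c) + c / 2 * (n * upsilon ε * S.toReal)) + c / 2 * (d * (Real.pi ^ 2 / B ^ 2)) := by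
    intro c hc
    refine natCast_le_of_ae_sum_lineDeriv_le hB hc hb ?_
    filter_upwards [hderiv] with θ hθ hθB
    have hθmem : θ ∈ cube d B := fun i => Ioo_subset_Icc_self (hθB i)
    have := hp.isProbabilityMeasure θ hθmem
    have := isProbabilityMeasure_outputLaw (law μ p θ) n K hK'
    have htr : (fisherInfo μ (cube d B) p θ).trace ≤ S.toReal :=
      (ENNReal.ofReal_le_iff_le_toReal hStop).1 (hS θ hθmem)
    calc ∑ j, (lineDeriv ℝ (b j) θ (EuclideanSpace.single j 1) + (b j θ - θ j) ^ 2 / (2 * c))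
        ≤ ∑ j, ((∫ z, (g j z - θ j) ^ 2 ∂(outputLaw (law μ p θ) n K)) / (2 * c) +
            c / 2 * (n * upsilon ε) * fisherInfo μ (cube d B) p θ j j) := by
          refine Finset.sum_le_sum fun j _ => ?_
          have hvar := integral_sub_sq (ν := outputLaw (law μ p θ) n K) (hg j) (hgB j)
            (outputMean μ p K (g j) θ)
          have hrisk := integral_sub_sq (ν := outputLaw (law μ p θ) n K) (hg j) (hgB j) (θ j)
          have hV : 0 ≤ ∫ z, (g j z - outputMean μ p K (g j) θ) ^ 2 ∂(outputLaw (law μ p θ) n K) :=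
            integral_nonneg fun z => sq_nonneg _
          have h1 := le_add_of_sq_le hc (mul_nonneg n.cast_nonneg (mul_nonneg (upsilon_nonneg ε)
            (fisherInfo_diag_nonneg (μ := μ) (p := p) (cube d B) θ j)))
            (by
              rw [hvar] at hV
              simp only [outputMean] at hV ⊢
              linarith) (hθ j hθB)
          rw [hrisk, ← hbe j hθmem]
          simp only [outputMean] at h1 ⊢
          refine (add_le_add_left h1 _).trans (le_of_eq ?_)
          ring
      _ = (∑ j, ∫ z, (g j z - θ j) ^ 2 ∂(outputLaw (law μ p θ) n K)) / (2 * c) +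
            c / 2 * (n * upsilon ε * (fisherInfo μ (cube d B) p θ).trace) := by
          rw [Finset.sum_add_distrib, ← Finset.sum_div, ← Finset.mul_sum, Matrix.trace]
          simp only [Matrix.diag_apply]
          ring
      _ ≤ R / (2 * c) + c / 2 * (n * upsilon ε * S.toReal) := by
          have := upsilon_nonneg ε
          gcongr
          exact hR θ hθmem
  set A := n * upsilon ε * S.toReal + d * Real.pi ^ 2 / B ^ 2 with hA
  have hd' : (0 : ℝ) < d := Nat.cast_pos.2 hd
  have hApos : 0 < A := by
    have := upsilon_nonneg ε
    have := Real.pi_pos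
    positivity
  -- The bound reads `d ≤ R/(2c) + cA/2`. The choice `c = d/A` makes the second term `d/2` and gives
  -- `d² ≤ R A`.
  have h1 := hmain (d / A) (by positivity)
  have h2 : R / (2 * (d / A)) + d / A / 2 * (n * upsilon ε * S.toReal) +
      d / A / 2 * (d * (Real.pi ^ 2 / B ^ 2)) = R * A / (2 * d) + d / 2 := by
    rw [add_assoc, ← mul_add, show n * upsilon ε * S.toReal + d * (Real.pi ^ 2 / B ^ 2) = A by
      rw [hA]; ring]
    field_simp
  rw [h2] at h1
  have h3 : (d : ℝ) / 2 ≤ R * A / (2 * d) := by linarith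
  rw [le_div_iff₀ (by positivity)] at h3
  linarith

end Bounded

theorem abs_max_min_sub_le {t a : ℝ} (ha : a ∈ Icc (-B) B) :
    |max (-B) (min t B) - a| ≤ |t - a| := by
  have h1 : |max (-B) (min t B) - max (-B) (min a B)| ≤ |t - a| := by
    rw [max_comm (-B), max_comm (-B)]
    exact (abs_max_sub_max_le_abs _ _ _).trans (abs_min_sub_min_le_max _ _ _ _ |>.trans (by simp))
  rwa [min_eq_left ha.2, max_eq_right ha.1] at h1

theorem IsRegularFamily.le_risk (hp : IsRegularFamily μ (cube d B) p) [SigmaFinite μ] (hB : 0 < B)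
    {S : ℝ≥0∞} (hStop : S ≠ ∞)
    (hS : ∀ θ ∈ cube d B, ENNReal.ofReal (fisherInfo μ (cube d B) p θ).trace ≤ S)
    {ε : ℝ} (hε : 0 < ε) {n : ℕ} {K : SeqProtocol X Z n} (hK : K.IsPrivate ε)
    {ψ : (Fin n → Z) → EuclideanSpace ℝ (Fin d)} (hψ : Measurable ψ) :
    (d : ℝ≥0∞) ^ 2 / ((n : ℝ≥0∞) * ENNReal.ofReal (upsilon ε) * S +
        ENNReal.ofReal (d * Real.pi ^ 2 / B ^ 2)) ≤
      ⨆ θ ∈ cube d B, ∫⁻ z, ENNReal.ofReal (quadraticLoss (ψ z) θ) ∂(outputLaw (law μ p θ) n K) := by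
  have hK' : ∀ i, IsMarkovKernel (K i) := fun i => (hK i).1
  set r := ⨆ θ ∈ cube d B, ∫⁻ z, ENNReal.ofReal (quadraticLoss (ψ z) θ)
    ∂(outputLaw (law μ p θ) n K) with hr
  obtain hrtop | hrtop := eq_or_ne r ∞
  · rw [hrtop]; exact le_top
  have hψj : ∀ j, Measurable fun z => ψ z j := fun j =>
    (lipschitzWith_eval j).continuous.measurable.comp hψ
  -- Clamping the estimator to the cube does not increase its loss and makes each coordinate a
  -- bounded statistic.
  set g : Fin d → (Fin n → Z) → ℝ := fun j z => max (-B) (min (ψ z j) B) with hgdef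
  have hg : ∀ j, Measurable (g j) := fun j =>
    measurable_const.max ((hψj j).min measurable_const)
  have hgB : ∀ j z, |g j z| ≤ B := fun j z => abs_le.2
    ⟨le_max_left _ _, max_le (by linarith) (min_le_right _ _)⟩
  have hR : ∀ θ ∈ cube d B,
      ∑ j, ∫ z, (g j z - θ j) ^ 2 ∂(outputLaw (law μ p θ) n K) ≤ r.toReal := by
    intro θ hθ
    have := hp.isProbabilityMeasure θ hθ
    have := isProbabilityMeasure_outputLaw (law μ p θ) n K hK'
    have hi : ∀ j, Integrable (fun z => (g j z - θ j) ^ 2) (outputLaw (law μ p θ) n K) :=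
      fun j => integrable_sq_of_abs_le ((hg j).sub_const _) (M := B + |θ j|) fun z =>
        (abs_sub _ _).trans (by gcongr; exact hgB j z)
    rw [← integral_finsetSum _ fun j _ => hi j, ← ENNReal.ofReal_le_iff_le_toReal hrtop,
      ofReal_integral_eq_lintegral_ofReal (integrable_finsetSum _ fun j _ => hi j)
        (.of_forall fun z => Finset.sum_nonneg fun j _ => sq_nonneg _)]
    refine le_trans (lintegral_mono fun z => ENNReal.ofReal_le_ofReal ?_)
      (le_iSup₂_of_le θ hθ le_rfl)
    rw [quadraticLoss, EuclideanSpace.norm_sq_eq]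
    refine Finset.sum_le_sum fun j _ => ?_
    rw [← sq_abs]
    exact pow_le_pow_left₀ (abs_nonneg _) (abs_max_min_sub_le (hθ j)) 2
  have h1 := hp.sq_le_risk_mul hB hStop hS hε hK hg hgB hR
  have hΥ := upsilon_nonneg ε
  refine ENNReal.div_le_of_le_mul ?_
  have e : (n : ℝ≥0∞) * ENNReal.ofReal (upsilon ε) * S + ENNReal.ofReal (d * Real.pi ^ 2 / B ^ 2) =
      ENNReal.ofReal (n * upsilon ε * S.toReal + d * Real.pi ^ 2 / B ^ 2) := by
    rw [ENNReal.ofReal_add (by positivity) (by positivity),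
      ENNReal.ofReal_mul (by positivity), ENNReal.ofReal_mul (by positivity),
      ENNReal.ofReal_toReal hStop, ENNReal.ofReal_natCast]
  rw [e, ← ENNReal.ofReal_toReal hrtop, ← ENNReal.ofReal_mul ENNReal.toReal_nonneg,
    ← ENNReal.ofReal_natCast, ← ENNReal.ofReal_pow d.cast_nonneg]
  exact ENNReal.ofReal_le_ofReal h1

/-- If the output law carries no information about the parameter, then the worst-case risk is at
least `d B²`. -/
theorem ofReal_mul_sq_le_iSup_of_const (hB : 0 < B) {n : ℕ} {Q : Measure (Fin n → Z)}
    [IsProbabilityMeasure Q] {Qθ : EuclideanSpace ℝ (Fin d) → Measure (Fin n → Z)}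
    (hQ : ∀ θ ∈ cube d B, Qθ θ = Q) {ψ : (Fin n → Z) → EuclideanSpace ℝ (Fin d)}
    (hψ : Measurable ψ) :
    ENNReal.ofReal (d * B ^ 2) ≤
      ⨆ θ ∈ cube d B, ∫⁻ z, ENNReal.ofReal (quadraticLoss (ψ z) θ) ∂(Qθ θ) := by
  set r := ⨆ θ ∈ cube d B, ∫⁻ z, ENNReal.ofReal (quadraticLoss (ψ z) θ) ∂(Qθ θ)
  set v : EuclideanSpace ℝ (Fin d) := WithLp.toLp 2 fun _ => B with hv
  have hvmem : v ∈ cube d B := fun j => ⟨by simp [hv]; linarith, by simp [hv]⟩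
  have hvmem' : -v ∈ cube d B := fun j => ⟨by simp [hv], by simp [hv]; linarith⟩
  have hle : ∀ θ ∈ cube d B, ∫⁻ z, ENNReal.ofReal (quadraticLoss (ψ z) θ) ∂Q ≤ r := fun θ hθ => by
    rw [← hQ θ hθ]
    exact le_iSup₂_of_le θ hθ le_rfl
  have hnorm : ‖v‖ ^ 2 = d * B ^ 2 := by
    rw [EuclideanSpace.norm_sq_eq]
    simp [hv]
  have hm : Measurable fun z => ENNReal.ofReal (quadraticLoss (ψ z) v) := by
    unfold quadraticLoss
    fun_prop
  have h1 : ENNReal.ofReal (2 * (d * B ^ 2)) ≤ 2 * r := calc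
    ENNReal.ofReal (2 * (d * B ^ 2)) = ∫⁻ _, ENNReal.ofReal (2 * (d * B ^ 2)) ∂Q := by simp
    _ ≤ ∫⁻ z, (ENNReal.ofReal (quadraticLoss (ψ z) v) +
          ENNReal.ofReal (quadraticLoss (ψ z) (-v))) ∂Q := by
        refine lintegral_mono fun z => ?_
        rw [quadraticLoss, quadraticLoss, sub_neg_eq_add,
          ← ENNReal.ofReal_add (sq_nonneg _) (sq_nonneg _)]
        refine ENNReal.ofReal_le_ofReal ?_
        have := parallelogram_law_with_norm ℝ (ψ z) v
        nlinarith [sq_nonneg ‖ψ z‖]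
    _ = ∫⁻ z, ENNReal.ofReal (quadraticLoss (ψ z) v) ∂Q +
          ∫⁻ z, ENNReal.ofReal (quadraticLoss (ψ z) (-v)) ∂Q := lintegral_add_left hm _
    _ ≤ r + r := add_le_add (hle _ hvmem) (hle _ hvmem')
    _ = 2 * r := (two_mul r).symm
  rw [ENNReal.ofReal_mul (by norm_num), ENNReal.ofReal_ofNat] at h1
  exact (ENNReal.mul_le_mul_iff_right (by simp) (by simp)).1 h1

/-- The output law does not depend on `θ`, so the risk is at least `d B²`, more than the required `d
B²/π²` when `d > 0`. -/
theorem IsRegularFamily.le_risk_of_const (hp : IsRegularFamily μ (cube d B) p) (hB : 0 < B)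
    {ε : ℝ} {n : ℕ} {K : SeqProtocol X Z n} (hK : K.IsPrivate ε) (hn : n = 0 ∨ ε = 0)
    {ψ : (Fin n → Z) → EuclideanSpace ℝ (Fin d)} (hψ : Measurable ψ) :
    (d : ℝ≥0∞) ^ 2 / ENNReal.ofReal (d * Real.pi ^ 2 / B ^ 2) ≤
      ⨆ θ ∈ cube d B, ∫⁻ z, ENNReal.ofReal (quadraticLoss (ψ z) θ) ∂(outputLaw (law μ p θ) n K) := by
  have h0 : (0 : EuclideanSpace ℝ (Fin d)) ∈ cube d B := fun j => by
    simp [hB.le]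
  have := hp.isProbabilityMeasure 0 h0
  have := isProbabilityMeasure_outputLaw (law μ p 0) n K fun i => (hK i).1
  refine le_trans ?_ (ofReal_mul_sq_le_iSup_of_const hB (Q := outputLaw (law μ p 0) n K)
    (Qθ := fun θ => outputLaw (law μ p θ) n K) ?_ hψ)
  · refine ENNReal.div_le_of_le_mul ?_
    rw [← ENNReal.ofReal_mul (by positivity), ← ENNReal.ofReal_natCast,
      ← ENNReal.ofReal_pow d.cast_nonneg]
    refine ENNReal.ofReal_le_ofReal ?_
    have e : d * B ^ 2 * (d * Real.pi ^ 2 / B ^ 2) = (d : ℝ) ^ 2 * Real.pi ^ 2 := by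
      field_simp
    rw [e]
    have hπ : 1 ≤ Real.pi ^ 2 := one_le_pow₀ (by linarith [Real.pi_gt_three])
    exact le_mul_of_one_le_right (sq_nonneg _) hπ
  · intro θ hθ
    have := hp.isProbabilityMeasure θ hθ
    obtain rfl | rfl := hn
    · simp only [outputLaw]
    · exact outputLaw_eq_of_isPrivate_zero _ _ n K hK

end VanTrees

end PrivateVanTrees

/-- Private van Trees inequality. The right-hand side is computed in `[0, ∞]`. -/
theorem corollary1 {X Z : Type*} [MeasurableSpace X] [MeasurableSpace Z]
    (μ : Measure X) [SigmaFinite μ] (d n : ℕ) (B ε : ℝ) (hB : 0 < B) (hε : 0 ≤ ε)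
    (p : EuclideanSpace ℝ (Fin d) → X → ℝ)
    (hp : PrivateVanTrees.IsRegularFamily μ (PrivateVanTrees.cube d B) p) :
    (d : ℝ≥0∞) ^ 2 /
        ((n : ℝ≥0∞) * ENNReal.ofReal (PrivateVanTrees.upsilon ε) *
            (⨆ θ ∈ PrivateVanTrees.cube d B,
              ENNReal.ofReal (PrivateVanTrees.fisherInfo μ (PrivateVanTrees.cube d B) p θ).trace) +
          ENNReal.ofReal (d * Real.pi ^ 2 / B ^ 2)) ≤
      PrivateVanTrees.minimaxRisk Z (PrivateVanTrees.law μ p) n (PrivateVanTrees.cube d B)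
        PrivateVanTrees.quadraticLoss ε := by
  rw [PrivateVanTrees.minimaxRisk]
  refine le_iInf₂ fun K hK => le_iInf₂ fun ψ hψ => ?_
  -- Here the coefficient of the supremum is zero, so the claim is nontrivial for `d > 0` even when
  -- the supremum is infinite, by the convention `0 · ∞ = 0`.
  by_cases hn : n = 0 ∨ ε = 0
  · have h0 : (n : ℝ≥0∞) * ENNReal.ofReal (PrivateVanTrees.upsilon ε) = 0 := by
      obtain rfl | rfl := hn <;> simp [PrivateVanTrees.upsilon]
    rw [h0, zero_mul, zero_add]
    exact hp.le_risk_of_const hB hK hn hψ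
  push Not at hn
  have hε' : 0 < ε := lt_of_le_of_ne hε hn.2.symm
  by_cases hS : (⨆ θ ∈ PrivateVanTrees.cube d B,
      ENNReal.ofReal (PrivateVanTrees.fisherInfo μ (PrivateVanTrees.cube d B) p θ).trace) = ∞
  · have hΥ : 0 < PrivateVanTrees.upsilon ε := by
      have : 1 < Real.exp ε := Real.one_lt_exp_iff.2 hε'
      exact pow_pos (div_pos (by linarith) (by linarith)) 2
    have h0 : (n : ℝ≥0∞) * ENNReal.ofReal (PrivateVanTrees.upsilon ε) ≠ 0 := by
      simp [hn.1, hΥ]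
    rw [hS, ENNReal.mul_top h0, top_add, ENNReal.div_top]
    exact zero_le
  · exact hp.le_risk hB hS (fun θ hθ => le_iSup₂_of_le θ hθ le_rfl) hε' hK hψ
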